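/- **Model.** Let $N,K\ge 1$ be integers with $K\mid N$, and let $r_\oplus,r_{\min},\alpha,p_s,p_i,\sigma^2>0$. Put $r_{\max}=\sqrt{2r_\oplus r_{\min}+r_{\min}^2}$. A user is at a fixed point of the sphere of radius $r_\oplus$ about the origin of $\mathbb R^3$, and $N$ satellites are placed independently and uniformly on the concentric sphere of radius $r_\oplus+r_{\min}$. A uniformly random assignment, independent of the positions, gives exactly $N/K$ satellites to each of $K$ channels. The satellites have i.i.d., almost surely positive fading gains $G_n$, of arbitrary distribution, independent of positions and assignment. $R_0$ is the distance from the user to the nearest (serving) satellite. The $N_I$ interferers are the satellites other than the serving one that share its channel and are at distance at most $r_{\max}$ from the user (above the horizon). With $R_n$ and $G_n$ the distance and the gain of the $n$-th interferer, $$I=\sum_{n=1}^{N_I}p_iG_nR_n^{-\alpha},\qquad \mathrm{SINR}=\frac{p_sG_0R_0^{-\alpha}}{I+\sigma^2},\qquad \mathrm{SNR}=\frac{p_sG_0R_0^{-\alpha}}{\sigma^2},\qquad \bar C=\frac1K\,\mathbb E[\log_2(1+\mathrm{SINR})].$$ The serving channel is non-fading, under either of two conventions: (a) $G_0=1$ always;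 (b) $G_0=1$ if $R_0\le r_{\max}$ and $G_0=0$ otherwise (a satellite below the horizon is not received). Let $$P_0(r)=\left(1-\frac{r_{\min}-(r^2-r_{\min}^2)/(2r_\oplus)}{2(r_\oplus+r_{\min})-(r^2-r_{\min}^2)/(2r_\oplus)}\right)^{N/K-1}\ (r\le r_{\max}),\qquad P_0(r)=1\ (r>r_{\max}),$$ let $F_{R_0}$ be the distribution function of $R_0$, let $h(r)=\mathbb E[\log_2(1+\mathrm{SINR})\mid R_0=r,\,N_I>0]$, and let $\mathcal L_I(s)=\mathcal L_I(s\mid r_0)=\mathbb E[e^{-sI}\mid R_0=r_0,\,N_I>0]$ (regular conditional distributions). **Theorem 4.** Under either convention the following hold, and all expectations and outer integrals below converge absolutely. 1. *Splitting.* $P_0(r)=\mathbb P(N_I=0\mid R_0=r)$ for almost every $r$ with respect to the law of $R_0$; for almost every such $r$, $$\tfrac1K\mathbb E[\log_2(1+\mathrm{SINR})\mid R_0=r]=\tfrac{P_0(r)}{K}\,\mathbb E[\log_2(1+\mathrm{SNR})\mid R_0=r]+\tfrac{1-P_0(r)}{K}\,h(r),$$ and on averaging over the serving distance, $$\bar C=\frac1K\,\mathbb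 E\big[P_0(R_0)\log_2(1+\mathrm{SNR})\big]+\frac1K\,\mathbb E\big[(1-P_0(R_0))\,h(R_0)\big],$$ where $\mathbb E[(1-P_0(R_0))h(R_0)]=\mathbb E[\log_2(1+\mathrm{SINR})\mathbf 1_{\{N_I>0\}}]$. 2. *SNR term.* Under convention (a), $$\mathbb E[\log_2(1+\mathrm{SNR})]=\frac1{\ln 2}\int_{t>0}F_{R_0}\!\left(\Big(\frac{p_s}{(e^t-1)\sigma^2}\Big)^{1/\alpha}\right)dt;$$ under convention (b) the same holds with the argument of $F_{R_0}$ replaced by its minimum with $r_{\max}$. 3. *SINR term.* If $K<N$, then $$\mathbb E\big[h(R_0)\mathbf 1_{\{R_0\le r_{\max}\}}\big]=\frac{N}{4\pi\ln(2)\,r_\oplus(r_\oplus+r_{\min})}\int_{r_{\min}}^{r_{\max}}\!\int_{t>0}\int_{-\infty}^{\infty}\mathcal L_I(j\omega)\,\frac{e^{j\left(\frac{p_s}{r_0^\alpha(e^t-1)}-\sigma^2\right)\omega}-1}{j\omega}\Big(1-\frac{r_0^2-r_{\min}^2}{4r_\oplus(r_\oplus+r_{\min})}\Big)^{N-1}r_0\,d\omega\,dt\,dr_0,$$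 where the integral over $\omega$ is the limit as $A\to\infty$ of the integrals over $[-A,A]$, which exists for almost every $r_0\in(r_{\min},r_{\max})$ and all $t>0$. 4. *Average rate.* Consequently, $$\bar C=\frac1K\mathbb E\big[P_0(R_0)\log_2(1+\mathrm{SNR})\big]+\frac{N}{4\pi\ln(2)K r_\oplus(r_\oplus+r_{\min})}\int_{r_{\min}}^{r_{\max}}\!\int_{t>0}(1-P_0(r_0))\int_{-\infty}^{\infty}\mathcal L_I(j\omega)\,\frac{e^{j\left(\frac{p_s}{r_0^\alpha(e^t-1)}-\sigma^2\right)\omega}-1}{j\omega}\Big(1-\frac{r_0^2-r_{\min}^2}{4r_\oplus(r_\oplus+r_{\min})}\Big)^{N-1}r_0\,d\omega\,dt\,dr_0$$ (for $K=N$ the second summand is $0$). -/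

import Mathlib

open MeasureTheory ProbabilityTheory Filter Topology

noncomputable section

namespace Leo

/-- Ambient space, with Earth's centre at the origin. -/
abbrev E3 : Type := EuclideanSpace ℝ (Fin 3)

/-- System parameters: `N` satellites, `K` channels, Earth radius `rE`, altitude `rMin`,
path loss exponent `alpha`, serving and interfering powers `pS`, `pI`, noise power `noise`
(this is `σ²`). -/
structure Params where
  N : ℕ
  K : ℕ
  rE : ℝ
  rMin : ℝ
  alpha : ℝ
  pS : ℝ
  pI : ℝ
  noise : ℝ

structure Params.Admissible (q : Params) : Prop where
  N_pos : 0 < q.N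
  K_pos : 0 < q.K
  K_dvd : q.K ∣ q.N
  rE_pos : 0 < q.rE
  rMin_pos : 0 < q.rMin
  alpha_pos : 0 < q.alpha
  pS_pos : 0 < q.pS
  pI_pos : 0 < q.pI
  noise_pos : 0 < q.noise

/-- Distance from the user to a satellite at the horizon. -/
def Params.rMax (q : Params) : ℝ := √(2 * q.rE * q.rMin + q.rMin ^ 2)

/-- `P_I`: visibility probability of another satellite when the serving distance is `r`. -/
def Params.probInterf (q : Params) (r : ℝ) : ℝ :=
  (q.rMin - (r ^ 2 - q.rMin ^ 2) / (2 * q.rE)) /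
    (2 * (q.rE + q.rMin) - (r ^ 2 - q.rMin ^ 2) / (2 * q.rE))

/-- `P_0`: probability of no interference when the serving distance is `r`. -/
def Params.P0 (q : Params) (r : ℝ) : ℝ :=
  if r ≤ q.rMax then (1 - q.probInterf r) ^ (q.N / q.K - 1) else 1

/-- The uniform probability measure on the sphere of radius `ρ` about the origin. -/
def uniformSphere (ρ : ℝ) : Measure E3 :=
  (cond (volume : Measure E3).toSphere Set.univ).map
    (fun y : Metric.sphere (0 : E3) 1 => ρ • (y : E3))

/-- Channel assignments that give exactly `N / K` satellites to every channel. -/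
def balanced (q : Params) : Set (Fin q.N → Fin q.K) :=
  {a | ∀ k, (Finset.univ.filter (fun i => a i = k)).card = q.N / q.K}

/-- The random network: i.i.d. satellite positions `X i`, uniform on the sphere of radius
`rE + rMin`; a uniformly random balanced channel assignment `c`; i.i.d. almost surely positive
fading gains `G i`; positions, gains and assignment are independent; the user `u` is on Earth. -/
structure IsNetwork (q : Params) {Ω : Type*} [MeasurableSpace Ω] (P : Measure Ω) (u : E3)
    (X : Fin q.N → Ω → E3) (c : Ω → Fin q.N → Fin q.K) (G : Fin q.N → Ω → ℝ) : Prop where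
  norm_user : ‖u‖ = q.rE
  measurable_X : ∀ i, Measurable (X i)
  measurable_c : Measurable c
  measurable_G : ∀ i, Measurable (G i)
  law_X : ∀ i, P.map (X i) = uniformSphere (q.rE + q.rMin)
  law_c : P.map c = uniformOn (balanced q)
  law_G : ∀ i j, IdentDistrib (G i) (G j) P P
  G_pos : ∀ i, ∀ᵐ w ∂P, 0 < G i w
  indep_X : iIndepFun X P
  indep_G : iIndepFun G P
  indep_X_G : IndepFun (fun w i => X i w) (fun w i => G i w) P
  indep_c : IndepFun (fun w => ((fun i => X i w), (fun i => G i w))) c P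

/-- Satellite `s` is the nearest one (the lowest index is taken in a tie, which has
probability zero); `d` is the vector of distances to the user. -/
def IsServing {n : ℕ} (d : Fin n → ℝ) (s : Fin n) : Prop :=
  (∀ j, d s ≤ d j) ∧ ∀ j, j < s → d s < d j

open Classical in
/-- The satellites other than the serving one that share its channel and are above the horizon. -/
def interferers (q : Params) (d : Fin q.N → ℝ) (a : Fin q.N → Fin q.K) : Finset (Fin q.N) :=
  Finset.univ.filter fun i => d i ≤ q.rMax ∧ ∃ s, IsServing d s ∧ i ≠ s ∧ a i = a s

/-- Convention for the gain `G_0` of the non-fading serving channel: equal to one always, or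
equal to one when the serving satellite is above the horizon and zero otherwise. -/
inductive ServingGain where
  | always
  | aboveHorizon

def ServingGain.gain (q : Params) : ServingGain → ℝ → ℝ
  | .always, _ => 1
  | .aboveHorizon, r => if r ≤ q.rMax then 1 else 0

/-- `SNR` at serving distance `r`. -/
def snr (q : Params) (g : ServingGain) (r : ℝ) : ℝ :=
  q.pS * g.gain q r * r ^ (-q.alpha) / q.noise

section RandomVariables

variable {Ω : Type*} (q : Params) (u : E3)
  (X : Fin q.N → Ω → E3) (c : Ω → Fin q.N → Fin q.K) (G : Fin q.N → Ω → ℝ)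

/-- Distances from the user to the satellites. -/
def dists (w : Ω) : Fin q.N → ℝ := fun i => dist (X i w) u

/-- Serving distance `R_0`. -/
def R0 (w : Ω) : ℝ := ⨅ i, dists q u X w i

/-- Number `N_I` of interfering satellites. -/
def NI (w : Ω) : ℕ := (interferers q (dists q u X w) (c w)).card

/-- Cumulative interference power `I`. -/
def interference (w : Ω) : ℝ :=
  ∑ i ∈ interferers q (dists q u X w) (c w), q.pI * G i w * (dists q u X w i) ^ (-q.alpha)

def sinr (g : ServingGain) (w : Ω) : ℝ :=
  q.pS * g.gain q (R0 q u X w) * (R0 q u X w) ^ (-q.alpha) / (interference q u X c G w + q.noise)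

variable [MeasurableSpace Ω] (P : Measure Ω) [IsFiniteMeasure P]

/-- Average achievable rate. -/
def avgRate (g : ServingGain) : ℝ :=
  1 / (q.K : ℝ) * ∫ w, Real.logb 2 (1 + sinr q u X c G g w) ∂P

/-- Conditional law of a random variable `Z` given `R_0 = r`. -/
def lawGivenR0 {S : Type*} [MeasurableSpace S] [StandardBorelSpace S] [Nonempty S]
    (Z : Ω → S) (r : ℝ) : Measure S :=
  condDistrib Z (R0 q u X) P r

/-- Conditional law of a random variable `Z` given `R_0 = r` and `N_I > 0`. -/
def lawGivenInterf (Z : Ω → ℝ) (r : ℝ) : Measure ℝ :=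
  condDistrib Z (fun w => (R0 q u X w, decide (0 < NI q u X c w))) P (r, true)

/-- `𝔼[log₂(1 + SINR) | R_0 = r, N_I > 0]`. -/
def rateGivenInterf (g : ServingGain) (r : ℝ) : ℝ :=
  ∫ z, z ∂(lawGivenInterf q u X c P (fun w => Real.logb 2 (1 + sinr q u X c G g w)) r)

/-- Laplace transform `L_I(s)` of the interference, given `R_0 = r` and `N_I > 0`. -/
def laplaceI (r : ℝ) (s : ℂ) : ℂ :=
  ∫ x, Complex.exp (-s * (x : ℂ)) ∂(lawGivenInterf q u X c P (interference q u X c G) r)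

/-- The integrand in `ω` of the SINR term: `L_I(jω)` times the Fourier kernel. -/
def fourierIntegrand (r t ω : ℝ) : ℂ :=
  laplaceI q u X c G P r (Complex.I * (ω : ℂ)) *
    ((Complex.exp (Complex.I *
        ((q.pS / (r ^ q.alpha * (Real.exp t - 1)) - q.noise : ℝ) : ℂ) * (ω : ℂ)) - 1) /
      (Complex.I * (ω : ℂ)))

end RandomVariables

/-- The improper integral of `f` over `ℝ` converges, as the limit of the integrals over `[-A, A]`. -/
def ImproperIntegrable (f : ℝ → ℂ) : Prop :=
  ∃ l : ℂ, Tendsto (fun A : ℝ => ∫ x in (-A)..A, f x) atTop (𝓝 l)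

/-- The improper integral of `f` over `ℝ`, meaningful when `ImproperIntegrable f`. -/
def improperIntegral (f : ℝ → ℂ) : ℂ :=
  limUnder atTop (fun A : ℝ => ∫ x in (-A)..A, f x)

end Leo

end

namespace Leo

/-! The theorem combines one computation each from geometry, order statistics and Fourier analysis.

Geometry: by the law of cosines, being within distance r of the user means lying in a spherical cap,
and the area of a cap is linear in its height. Above the horizon the distance to one satellite
therefore has a distribution function F (`Params.distCdf`) that is quadratic in r, hence a density
(`distLaw_Iic`, `distLaw_restrict_Iic`).

Order statistics: given a serving distance r up to the horizon, the other distances are independent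
and conditioned to exceed r. A balanced assignment always leaves N/K - 1 of them in the serving
channel, so none is visible with probability ((1 - F(r_max)) / (1 - F(r)))^(N/K - 1), which is
P_0(r). The precise form is an identity of measures, `map_R0_restrict_NI_eq_zero`: P_0 is the
density of the law of R_0 on {N_I = 0} with respect to the law of R_0. Integrating the rate over
{N_I = 0} and {N_I > 0} gives the splitting; the layer-cake formula gives the SNR term.

Fourier analysis: for a probability measure κ on (0, ∞), the symmetric Fourier integral with
parameter b converges to 2π κ(x < b), up to the atom at b (`tendsto_intervalIntegral_gilPelaez`).
With b = `threshold`, the condition x < b says that the rate exceeds t nats. Integrating over t > 0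
recovers the mean logarithm, and atoms affect only a null set of t for each x (`integral_signTail`).
This is applied to the law of I given R_0 = r and N_I > 0, then weighted by the density of R_0. That
conditional law is determined only up to null sets of the law of R_0 on {N_I > 0}; for K < N these
are Lebesgue-null in (r_min, r_max) by `volume_absolutelyContinuous_map_R0_NI_pos`. -/

/-! ### The Dirichlet integral, with a rate of convergence and a uniform bound. -/

/-- The sine integral. -/
noncomputable def sinInt (A : ℝ) : ℝ := ∫ x in (0 : ℝ)..A, Real.sinc x

theorem sinInt_neg (A : ℝ) : sinInt (-A) = -sinInt A := by
  unfold sinInt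
  have h := intervalIntegral.integral_comp_neg (a := 0) (b := A) Real.sinc
  simp only [Real.sinc_neg, neg_zero] at h
  rw [h, intervalIntegral.integral_symm]

theorem continuous_sinInt : Continuous sinInt :=
  intervalIntegral.continuous_primitive
    (fun _ _ => Real.continuous_sinc.intervalIntegrable _ _) 0

theorem integral_sin_mul_exp_neg (s A : ℝ) :
    ∫ x in (0 : ℝ)..A, Real.sin x * Real.exp (-(x * s)) =
      (1 - Real.exp (-(A * s)) * (s * Real.sin A + Real.cos A)) * (1 + s ^ 2)⁻¹ := by
  have hs : (1 + s ^ 2) ≠ 0 := by positivity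
  have hd : ∀ x : ℝ, HasDerivAt
      (fun x => -(Real.exp (-(x * s)) * (s * Real.sin x + Real.cos x)) * (1 + s ^ 2)⁻¹)
      (Real.sin x * Real.exp (-(x * s))) x := by
    intro x
    have h1 : HasDerivAt (fun x : ℝ => Real.exp (-(x * s))) (Real.exp (-(x * s)) * (-(1 * s))) x :=
      (((hasDerivAt_id x).mul_const s).neg).exp
    have h2 : HasDerivAt (fun x : ℝ => s * Real.sin x + Real.cos x)
        (s * Real.cos x + -Real.sin x) x :=
      ((Real.hasDerivAt_sin x).const_mul s).add (Real.hasDerivAt_cos x)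
    convert! ((h1.mul h2).neg).mul_const (1 + s ^ 2)⁻¹ using 1
    field_simp
    ring
  rw [intervalIntegral.integral_eq_sub_of_hasDerivAt (fun x _ => hd x)
    ((by fun_prop : Continuous fun x : ℝ => Real.sin x * Real.exp (-(x * s))).intervalIntegrable _ _)]
  simp
  ring

theorem integral_Ioi_exp_neg_mul {x : ℝ} (hx : 0 < x) :
    ∫ s in Set.Ioi (0 : ℝ), Real.exp (-(x * s)) = x⁻¹ := by
  have h := integral_exp_mul_Ioi (neg_lt_zero.mpr hx) 0
  simp only [mul_zero, Real.exp_zero, neg_mul] at h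
  rw [h]
  field_simp

theorem integrableOn_Ioi_exp_neg_mul {x : ℝ} (hx : 0 < x) :
    IntegrableOn (fun s => Real.exp (-(x * s))) (Set.Ioi (0 : ℝ)) := by
  simpa only [neg_mul] using integrableOn_exp_mul_Ioi (neg_lt_zero.mpr hx) 0

/-- Integrating the absolute value in the second variable gives |sinc|, which is bounded on the
bounded interval. -/
theorem integrable_sin_mul_exp_neg_prod (A : ℝ) :
    Integrable (fun p : ℝ × ℝ => Real.sin p.1 * Real.exp (-(p.1 * p.2)))
      ((volume.restrict (Set.Ioc 0 A)).prod (volume.restrict (Set.Ioi 0))) := by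
  rw [integrable_prod_iff (by fun_prop)]
  constructor
  · filter_upwards [ae_restrict_mem measurableSet_Ioc] with x hx
    exact (integrableOn_Ioi_exp_neg_mul hx.1).const_mul _
  · have : IntegrableOn (fun x => |Real.sinc x|) (Set.Ioc 0 A) :=
      (Real.continuous_sinc.abs.integrableOn_Icc).mono_set Set.Ioc_subset_Icc_self
    refine this.congr ?_
    filter_upwards [ae_restrict_mem measurableSet_Ioc] with x hx
    simp only [norm_mul, Real.norm_eq_abs, Real.abs_exp]
    rw [integral_const_mul, integral_Ioi_exp_neg_mul hx.1, Real.sinc_of_ne_zero hx.1.ne', abs_div,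
      abs_of_pos hx.1, div_eq_mul_inv]

/-- Write 1/x as the integral of exp(-xs) over s > 0 and exchange the integrals; the inner integral
in x is elementary. -/
theorem sinInt_eq_integral_Ioi {A : ℝ} (hA : 0 ≤ A) :
    sinInt A = ∫ s in Set.Ioi (0 : ℝ),
      (1 - Real.exp (-(A * s)) * (s * Real.sin A + Real.cos A)) * (1 + s ^ 2)⁻¹ := by
  have h := integral_integral_swap
    (f := fun x s : ℝ => Real.sin x * Real.exp (-(x * s))) (integrable_sin_mul_exp_neg_prod A)
  simp_rw [← intervalIntegral.integral_of_le hA, integral_sin_mul_exp_neg] at h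
  rw [← h, sinInt, intervalIntegral.integral_of_le hA, intervalIntegral.integral_of_le hA]
  refine setIntegral_congr_fun measurableSet_Ioc fun x hx => ?_
  rw [integral_const_mul, integral_Ioi_exp_neg_mul hx.1, Real.sinc_of_ne_zero hx.1.ne',
    div_eq_mul_inv]

/-- The term 1/(1 + s²) integrates to π/2. The rest is at most 2 exp(-As), because (s + 1)/(1 + s²)
≤ 2 for s > 0. -/
theorem abs_sinInt_sub_pi_div_two_le {A : ℝ} (hA : 0 < A) :
    |sinInt A - Real.pi / 2| ≤ 2 * A⁻¹ := by
  have hb : ∀ s ∈ Set.Ioi (0 : ℝ),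
      ‖Real.exp (-(A * s)) * (s * Real.sin A + Real.cos A) * (1 + s ^ 2)⁻¹‖ ≤
        2 * Real.exp (-(A * s)) := by
    intro s hs
    have hs' : (0 : ℝ) < s := hs
    rw [norm_mul, norm_mul, Real.norm_eq_abs, Real.norm_eq_abs, Real.norm_eq_abs, Real.abs_exp,
      abs_of_pos (by positivity : 0 < (1 + s ^ 2)⁻¹)]
    have h1 : |s * Real.sin A + Real.cos A| ≤ s + 1 := by
      refine (abs_add_le _ _).trans (add_le_add ?_ (Real.abs_cos_le_one A))
      rw [abs_mul, abs_of_pos hs']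
      exact mul_le_of_le_one_right hs'.le (Real.abs_sin_le_one A)
    have h2 : |s * Real.sin A + Real.cos A| * (1 + s ^ 2)⁻¹ ≤ 2 := by
      rw [← div_eq_mul_inv, div_le_iff₀ (by positivity)]
      nlinarith [sq_nonneg (s - 1)]
    nlinarith [Real.exp_pos (-(A * s))]
  have hint : IntegrableOn (fun s => 2 * Real.exp (-(A * s))) (Set.Ioi (0 : ℝ)) :=
    (integrableOn_Ioi_exp_neg_mul hA).const_mul 2
  have hint' : IntegrableOn
      (fun s => Real.exp (-(A * s)) * (s * Real.sin A + Real.cos A) * (1 + s ^ 2)⁻¹)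
      (Set.Ioi (0 : ℝ)) := by
    refine Integrable.mono' hint (by fun_prop) ?_
    filter_upwards [ae_restrict_mem measurableSet_Ioi] with s hs using hb s hs
  have hsplit : sinInt A - Real.pi / 2 = -∫ s in Set.Ioi (0 : ℝ),
      Real.exp (-(A * s)) * (s * Real.sin A + Real.cos A) * (1 + s ^ 2)⁻¹ := by
    rw [sinInt_eq_integral_Ioi hA.le]
    simp_rw [sub_mul, one_mul]
    rw [integral_sub integrable_inv_one_add_sq.integrableOn hint', integral_Ioi_inv_one_add_sq]
    simp
  rw [hsplit, abs_neg, ← Real.norm_eq_abs]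
  refine (norm_integral_le_of_norm_le hint ?_).trans ?_
  · filter_upwards [ae_restrict_mem measurableSet_Ioi] with s hs using hb s hs
  · rw [integral_const_mul, integral_Ioi_exp_neg_mul hA]

theorem tendsto_sinInt_atTop : Tendsto sinInt atTop (𝓝 (Real.pi / 2)) := by
  rw [tendsto_iff_norm_sub_tendsto_zero]
  have h : Tendsto (fun A : ℝ => 2 * A⁻¹) atTop (𝓝 0) := by
    simpa using tendsto_inv_atTop_zero.const_mul (2 : ℝ)
  refine squeeze_zero' (Eventually.of_forall fun _ => norm_nonneg _) ?_ h
  filter_upwards [eventually_gt_atTop 0] with A hA using abs_sinInt_sub_pi_div_two_le hA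

/-- Supplies a dominating constant independent of A. On [0, 1] use |sinc| ≤ 1; beyond 1 use π/2 + 2
≤ 4. -/
theorem abs_sinInt_le (A : ℝ) : |sinInt A| ≤ 4 := by
  have key : ∀ B : ℝ, 0 ≤ B → |sinInt B| ≤ 4 := by
    intro B hB
    rcases le_total B 1 with h | h
    · have := intervalIntegral.norm_integral_le_of_norm_le_const (a := 0) (b := B) (C := 1)
        (f := Real.sinc) (fun x _ => Real.abs_sinc_le_one x)
      rw [sub_zero, abs_of_nonneg hB, one_mul, Real.norm_eq_abs] at this
      exact this.trans (by linarith)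
    · have h1 := abs_sinInt_sub_pi_div_two_le (by linarith : 0 < B)
      have h2 : B⁻¹ ≤ 1 := inv_le_one_of_one_le₀ h
      have h3 := Real.pi_le_four
      have h4 := Real.pi_pos
      rw [abs_le] at h1 ⊢
      constructor <;> linarith [h1.1, h1.2]
  rcases le_total 0 A with h | h
  · exact key A h
  · have := key (-A) (by linarith)
    rwa [sinInt_neg, abs_neg] at this

theorem tendsto_sinInt_mul (y : ℝ) :
    Tendsto (fun A => 2 * sinInt (A * y)) atTop (𝓝 (Real.pi * Real.sign y)) := by
  rcases lt_trichotomy y 0 with h | h | h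
  · have h1 : Tendsto (fun A : ℝ => A * (-y)) atTop atTop :=
      tendsto_id.atTop_mul_const (by linarith)
    have h2 := ((tendsto_sinInt_atTop.comp h1).const_mul (-2))
    rw [Real.sign_of_neg h]
    convert! h2 using 2
    · simp only [Function.comp_apply, mul_neg, sinInt_neg]; ring
    · ring
  · subst h
    simp [sinInt]
  · have h1 : Tendsto (fun A : ℝ => A * y) atTop atTop := tendsto_id.atTop_mul_const h
    have h2 := ((tendsto_sinInt_atTop.comp h1).const_mul 2)
    rw [Real.sign_of_pos h]
    convert! h2 using 2
    ring

theorem integral_mul_sinc_mul (A y : ℝ) :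
    ∫ ω in (-A)..A, y * Real.sinc (ω * y) = 2 * sinInt (A * y) := by
  rw [intervalIntegral.integral_const_mul, intervalIntegral.mul_integral_comp_mul_right,
    ← intervalIntegral.integral_add_adjacent_intervals (b := 0)
      (Real.continuous_sinc.intervalIntegrable _ _) (Real.continuous_sinc.intervalIntegrable _ _),
    intervalIntegral.integral_symm]
  change -sinInt (-A * y) + sinInt (A * y) = _
  rw [neg_mul, sinInt_neg]
  ring

/-! ### Inversion of the Fourier integral. -/

/-- The kernel `e^{-iωx} (e^{ibω} - 1) / (iω)`. -/
noncomputable def gilPelaezKernel (b x ω : ℝ) : ℂ :=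
  Complex.exp (-(Complex.I * (ω : ℂ)) * (x : ℂ)) *
    ((Complex.exp (Complex.I * (b : ℂ) * (ω : ℂ)) - 1) / (Complex.I * (ω : ℂ)))

theorem measurable_gilPelaezKernel (b : ℝ) :
    Measurable (fun p : ℝ × ℝ => gilPelaezKernel b p.2 p.1) := by
  unfold gilPelaezKernel
  fun_prop

/-- From |exp(iθ) - 1| ≤ |θ|. Uniformity in x and ω is what permits exchanging the ω-integral over
[-A, A] with the x-integral; at ω = 0 the quotient has the default value 0. -/
theorem norm_gilPelaezKernel_le (b x ω : ℝ) : ‖gilPelaezKernel b x ω‖ ≤ |b| := by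
  unfold gilPelaezKernel
  have h1 : ‖Complex.exp (-(Complex.I * (ω : ℂ)) * (x : ℂ))‖ = 1 := by
    rw [Complex.norm_exp]
    simp
  rw [norm_mul, h1, one_mul, norm_div, norm_mul, Complex.norm_I, one_mul, Complex.norm_real]
  refine div_le_of_le_mul₀ (norm_nonneg _) (abs_nonneg _) ?_
  have := Real.norm_exp_I_mul_ofReal_sub_one_le (x := b * ω)
  rw [Real.norm_eq_abs, abs_mul] at this
  simpa [mul_assoc] using this

/-- Pairing ω with -ω cancels the odd part and leaves sines over ω, which is why integrals over
symmetric intervals converge. Writing sin(ωy)/ω as y sinc(ωy) removes the singularity at 0. -/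
theorem gilPelaezKernel_add_neg (b x : ℝ) {ω : ℝ} (hω : ω ≠ 0) :
    gilPelaezKernel b x ω + gilPelaezKernel b x (-ω) =
      ((2 * ((b - x) * Real.sinc (ω * (b - x)) + x * Real.sinc (ω * x)) : ℝ) : ℂ) := by
  have hs : ∀ y : ℝ, y * Real.sinc (ω * y) = Real.sin (ω * y) / ω := by
    intro y
    rcases eq_or_ne y 0 with rfl | hy
    · simp
    · rw [Real.sinc_of_ne_zero (mul_ne_zero hω hy)]
      field_simp
  rw [hs, hs]
  unfold gilPelaezKernel
  have hω' : (ω : ℂ) ≠ 0 := by exact_mod_cast hω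
  push_cast
  rw [Complex.sin, Complex.sin]
  have e1 : Complex.exp (-(Complex.I * ω) * x) = Complex.exp (-(ω * x) * Complex.I) := by ring_nf
  have e2 : Complex.exp (-(Complex.I * (-ω)) * x) = Complex.exp ((ω * x) * Complex.I) := by ring_nf
  have e3 : Complex.exp (ω * (b - x) * Complex.I) =
      Complex.exp (Complex.I * b * ω) * Complex.exp (-(ω * x) * Complex.I) := by
    rw [← Complex.exp_add]; ring_nf
  have e4 : Complex.exp (-(ω * (b - x)) * Complex.I) =
      Complex.exp (Complex.I * b * (-ω)) * Complex.exp ((ω * x) * Complex.I) := by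
    rw [← Complex.exp_add]; ring_nf
  rw [e1, e2, e3, e4]
  have hI := Complex.I_sq
  field_simp
  rw [hI]
  ring

theorem intervalIntegral_gilPelaezKernel (b x A : ℝ) :
    ∫ ω in (-A)..A, gilPelaezKernel b x ω =
      ((2 * sinInt (A * (b - x)) + 2 * sinInt (A * x) : ℝ) : ℂ) := by
  have hint : ∀ a c : ℝ, IntervalIntegrable (gilPelaezKernel b x) volume a c := by
    intro a c
    refine (intervalIntegrable_const (c := |b|)).mono_fun ?_ ?_
    · exact ((measurable_gilPelaezKernel b).comp
        (measurable_id.prodMk measurable_const)).aestronglyMeasurable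
    · exact Eventually.of_forall fun ω => (norm_gilPelaezKernel_le b x ω).trans (le_abs_self _)
  have hneg : ∫ ω in (-A)..A, gilPelaezKernel b x (-ω) = ∫ ω in (-A)..A, gilPelaezKernel b x ω := by
    rw [intervalIntegral.integral_comp_neg, neg_neg]
  have h2 : (2 : ℂ) * ∫ ω in (-A)..A, gilPelaezKernel b x ω =
      ∫ ω in (-A)..A, (gilPelaezKernel b x ω + gilPelaezKernel b x (-ω)) := by
    rw [intervalIntegral.integral_add (hint _ _)
      (by simpa [div_neg] using (hint A (-A)).comp_mul_left (c := -1)), hneg]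
    ring
  have h3 : ∫ ω in (-A)..A, (gilPelaezKernel b x ω + gilPelaezKernel b x (-ω)) =
      ∫ ω in (-A)..A,
        ((2 * ((b - x) * Real.sinc (ω * (b - x)) + x * Real.sinc (ω * x)) : ℝ) : ℂ) := by
    refine intervalIntegral.integral_congr_ae ?_
    filter_upwards [Measure.ae_ne volume (0 : ℝ)] with ω hω _
      using gilPelaezKernel_add_neg b x hω
  have hc : ∀ y : ℝ, Continuous fun ω : ℝ => y * Real.sinc (ω * y) := fun y =>
    continuous_const.mul (Real.continuous_sinc.comp (by fun_prop))
  rw [h3, intervalIntegral.integral_ofReal, intervalIntegral.integral_const_mul,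
    intervalIntegral.integral_add ((hc _).intervalIntegrable _ _) ((hc _).intervalIntegrable _ _),
    integral_mul_sinc_mul, integral_mul_sinc_mul] at h2
  have : (2 : ℂ) ≠ 0 := two_ne_zero
  apply mul_left_cancel₀ this
  rw [h2]
  push_cast
  ring

/-- Gil-Pelaez type inversion formula for a probability measure on the line. -/
theorem tendsto_intervalIntegral_gilPelaez (κ : Measure ℝ) [IsProbabilityMeasure κ] (b : ℝ) :
    Tendsto (fun A : ℝ => ∫ ω in (-A)..A,
        (∫ x, Complex.exp (-(Complex.I * (ω : ℂ)) * (x : ℂ)) ∂κ) *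
          ((Complex.exp (Complex.I * (b : ℂ) * (ω : ℂ)) - 1) / (Complex.I * (ω : ℂ))))
      atTop (𝓝 ((∫ x, Real.pi * (Real.sign (b - x) + Real.sign x) ∂κ : ℝ) : ℂ)) := by
  have hswap : ∀ A : ℝ, 0 ≤ A → ∫ ω in (-A)..A,
        (∫ x, Complex.exp (-(Complex.I * (ω : ℂ)) * (x : ℂ)) ∂κ) *
          ((Complex.exp (Complex.I * (b : ℂ) * (ω : ℂ)) - 1) / (Complex.I * (ω : ℂ))) =
        ((∫ x, (2 * sinInt (A * (b - x)) + 2 * sinInt (A * x)) ∂κ : ℝ) : ℂ) := by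
    intro A hA
    simp_rw [← integral_mul_const]
    change ∫ ω in (-A)..A, ∫ x, gilPelaezKernel b x ω ∂κ = _
    rw [intervalIntegral.integral_of_le (by linarith), integral_integral_swap]
    · rw [← integral_complex_ofReal]
      refine integral_congr_ae (Eventually.of_forall fun x => ?_)
      simp only
      rw [← intervalIntegral.integral_of_le (by linarith)]
      exact intervalIntegral_gilPelaezKernel b x A
    · refine Integrable.of_bound (measurable_gilPelaezKernel b).aestronglyMeasurable |b| ?_
      exact Eventually.of_forall fun p => norm_gilPelaezKernel_le b p.2 p.1
  have hreal : Tendsto (fun A : ℝ => ∫ x, (2 * sinInt (A * (b - x)) + 2 * sinInt (A * x)) ∂κ)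
      atTop (𝓝 (∫ x, Real.pi * (Real.sign (b - x) + Real.sign x) ∂κ)) := by
    -- 16 = 2·4 + 2·4, from the bound in `abs_sinInt_le`.
    refine tendsto_integral_filter_of_dominated_convergence (fun _ => 16) ?_ ?_
      (integrable_const _) ?_
    · refine Eventually.of_forall fun A => Continuous.aestronglyMeasurable ?_
      have := continuous_sinInt
      fun_prop
    · refine Eventually.of_forall fun A => Eventually.of_forall fun x => ?_
      have h1 := abs_le.1 (abs_sinInt_le (A * (b - x)))
      have h2 := abs_le.1 (abs_sinInt_le (A * x))
      rw [Real.norm_eq_abs, abs_le]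
      constructor <;> linarith [h1.1, h1.2, h2.1, h2.2]
    · refine Eventually.of_forall fun x => ?_
      rw [mul_add]
      exact (tendsto_sinInt_mul _).add (tendsto_sinInt_mul _)
  refine ((Complex.continuous_ofReal.tendsto _).comp hreal).congr' ?_
  filter_upwards [eventually_ge_atTop 0] with A hA
  exact (hswap A hA).symm

/-! ### Area of a spherical cap, by slicing the cone over it. -/

theorem volume_open_disc {s : ℝ} (hs : 0 ≤ s) :
    volume {v : Fin 2 → ℝ | v 0 ^ 2 + v 1 ^ 2 < s} = ENNReal.ofReal (Real.pi * s) := by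
  have h := (PiLp.volume_preserving_toLp (Fin 2)).measure_preimage
    (s := Metric.ball (0 : EuclideanSpace ℝ (Fin 2)) (√s)) measurableSet_ball.nullMeasurableSet
  rw [EuclideanSpace.volume_ball_fin_two, ← ENNReal.ofReal_pow (Real.sqrt_nonneg s),
    Real.sq_sqrt hs, ← ENNReal.ofReal_mul hs, mul_comm s] at h
  rw [← h]
  congr 1
  ext v
  simp only [Set.mem_ofPred_eq, Set.mem_preimage, mem_ball_zero_iff, EuclideanSpace.norm_eq,
    Fin.sum_univ_two, Real.norm_eq_abs, sq_abs]
  rw [Real.sqrt_lt_sqrt_iff (by positivity)]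

theorem volume_closed_disc {s : ℝ} (hs : 0 ≤ s) :
    volume {v : Fin 2 → ℝ | v 0 ^ 2 + v 1 ^ 2 ≤ s} = ENNReal.ofReal (Real.pi * s) := by
  have h := (PiLp.volume_preserving_toLp (Fin 2)).measure_preimage
    (s := Metric.closedBall (0 : EuclideanSpace ℝ (Fin 2)) (√s))
    measurableSet_closedBall.nullMeasurableSet
  rw [EuclideanSpace.volume_closedBall_fin_two, ← ENNReal.ofReal_pow (Real.sqrt_nonneg s),
    Real.sq_sqrt hs, ← ENNReal.ofReal_mul hs, mul_comm s] at h
  rw [← h]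
  congr 1
  ext v
  simp only [Set.mem_ofPred_eq, Set.mem_preimage, mem_closedBall_zero_iff, EuclideanSpace.norm_eq,
    Fin.sum_univ_two, Real.norm_eq_abs, sq_abs]
  rw [Real.sqrt_le_sqrt_iff hs]

/-- The part of the unit ball in a spherical cone, in coordinates adapted to its axis. -/
def coordCone (t : ℝ) : Set (ℝ × (Fin 2 → ℝ)) :=
  {p | 0 < p.1 ∧ p.1 ^ 2 + (p.2 0 ^ 2 + p.2 1 ^ 2) < 1 ∧
    t ^ 2 * (p.1 ^ 2 + (p.2 0 ^ 2 + p.2 1 ^ 2)) ≤ p.1 ^ 2}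

theorem measurableSet_coordCone (t : ℝ) : MeasurableSet (coordCone t) := by
  have h1 : Measurable fun p : ℝ × (Fin 2 → ℝ) => p.1 ^ 2 + (p.2 0 ^ 2 + p.2 1 ^ 2) := by fun_prop
  exact (measurableSet_lt measurable_const measurable_fst).inter
    ((measurableSet_lt h1 measurable_const).inter
    (measurableSet_le (h1.const_mul (t ^ 2)) (measurable_fst.pow_const 2)))

/-- At height z the cone asks |v|² ≤ z²(1/t² - 1) and the ball asks |v|² < 1 - z². The two bounds
cross at z = t: below it the slice is the closed disc of the cone, from it on the open disc of the
ball. -/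
theorem volume_slice_coordCone {t : ℝ} (ht : 0 < t) (ht1 : t ≤ 1) (z : ℝ) :
    volume (Prod.mk z ⁻¹' coordCone t) =
      (Set.Ioo (0 : ℝ) 1).indicator (fun z => ENNReal.ofReal
        (Real.pi * if z < t then z ^ 2 * (1 / t ^ 2 - 1) else 1 - z ^ 2)) z := by
  by_cases hz : z ∈ Set.Ioo (0 : ℝ) 1
  · rw [Set.indicator_of_mem hz]
    obtain ⟨h0, h1⟩ := hz
    split_ifs with hzt
    · rw [← volume_closed_disc (mul_nonneg (sq_nonneg z) (by
        rw [sub_nonneg, le_div_iff₀ (by positivity)]; nlinarith))]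
      congr 1
      ext v
      simp only [coordCone, Set.mem_preimage, Set.mem_ofPred_eq]
      have e : z ^ 2 * (1 / t ^ 2 - 1) = z ^ 2 / t ^ 2 - z ^ 2 := by ring
      rw [e, le_sub_iff_add_le, add_comm _ (z ^ 2), le_div_iff₀ (by positivity), mul_comm _ (t ^ 2)]
      refine ⟨fun h => h.2.2, fun h => ⟨h0, ?_, h⟩⟩
      have : z ^ 2 < t ^ 2 := by nlinarith
      have h3 : t ^ 2 * (z ^ 2 + (v 0 ^ 2 + v 1 ^ 2)) < t ^ 2 * 1 := by linarith
      exact lt_of_mul_lt_mul_left h3 (by positivity)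
    · rw [← volume_open_disc (by nlinarith)]
      congr 1
      ext v
      simp only [coordCone, Set.mem_preimage, Set.mem_ofPred_eq]
      rw [lt_sub_iff_add_lt, add_comm _ (z ^ 2)]
      refine ⟨fun h => h.2.1, fun h => ⟨h0, h, ?_⟩⟩
      push Not at hzt
      have : t ^ 2 ≤ z ^ 2 := by nlinarith
      nlinarith [sq_nonneg t]
  · rw [Set.indicator_of_notMem hz]
    convert! measure_empty (μ := (volume : Measure (Fin 2 → ℝ)))
    ext v
    simp only [coordCone, Set.mem_preimage, Set.mem_ofPred_eq, Set.mem_empty_iff_false, iff_false,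
      not_and]
    intro h0 h1
    exact absurd ⟨h0, by nlinarith [sq_nonneg (v 0), sq_nonneg (v 1)]⟩ hz

theorem volume_coordCone {t : ℝ} (ht : 0 < t) (ht1 : t ≤ 1) :
    volume (coordCone t) = ENNReal.ofReal (2 * Real.pi / 3 * (1 - t)) := by
  rw [Measure.volume_eq_prod, Measure.prod_apply (measurableSet_coordCone t)]
  simp_rw [volume_slice_coordCone ht ht1]
  rw [lintegral_indicator measurableSet_Ioo]
  set f : ℝ → ℝ := fun z =>
    Real.pi * if z < t then z ^ 2 * (1 / t ^ 2 - 1) else 1 - z ^ 2 with hf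
  have hcoef : 0 ≤ 1 / t ^ 2 - 1 := by
    rw [sub_nonneg, le_div_iff₀ (by positivity)]; nlinarith
  have hnn : ∀ z ∈ Set.Ioc (0 : ℝ) 1, 0 ≤ f z := by
    intro z hz
    simp only [hf]
    have := Real.pi_pos
    split_ifs
    · positivity
    · exact mul_nonneg this.le (by nlinarith [hz.1, hz.2])
  have hmeas : Measurable f := by
    refine measurable_const.mul (Measurable.ite measurableSet_Iio (by fun_prop) (by fun_prop))
  have e1 : Set.EqOn f (fun z => Real.pi * (z ^ 2 * (1 / t ^ 2 - 1))) (Set.Ioo 0 t) := by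
    intro z hz
    simp [hf, hz.2]
  have e2 : Set.EqOn f (fun z => Real.pi * (1 - z ^ 2)) (Set.Ioc t 1) := by
    intro z hz
    simp [hf, not_lt.2 hz.1.le]
  have i1 : IntervalIntegrable f volume 0 t := by
    rw [intervalIntegrable_iff_integrableOn_Ioo_of_le ht.le]
    refine IntegrableOn.congr_fun ?_ e1.symm measurableSet_Ioo
    exact ((by fun_prop : Continuous fun z : ℝ => Real.pi * (z ^ 2 * (1 / t ^ 2 - 1))).integrableOn_Icc).mono_set
      Set.Ioo_subset_Icc_self
  have i2 : IntervalIntegrable f volume t 1 := by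
    rw [intervalIntegrable_iff_integrableOn_Ioc_of_le ht1]
    refine IntegrableOn.congr_fun ?_ e2.symm measurableSet_Ioc
    exact ((by fun_prop : Continuous fun z : ℝ => Real.pi * (1 - z ^ 2)).integrableOn_Icc).mono_set
      Set.Ioc_subset_Icc_self
  have i3 := i1.trans i2
  rw [intervalIntegrable_iff_integrableOn_Ioc_of_le zero_le_one] at i3
  rw [restrict_Ioo_eq_restrict_Ioc, ← ofReal_integral_eq_lintegral_ofReal i3
    ((ae_restrict_iff' measurableSet_Ioc).2 (Eventually.of_forall hnn)),
    ← intervalIntegral.integral_of_le zero_le_one,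
    ← intervalIntegral.integral_add_adjacent_intervals i1 i2]
  congr 1
  have v1 : ∫ z in (0 : ℝ)..t, f z = Real.pi * (t ^ 3 / 3 * (1 / t ^ 2 - 1)) := by
    rw [intervalIntegral.integral_of_le ht.le, integral_Ioc_eq_integral_Ioo,
      setIntegral_congr_fun measurableSet_Ioo e1, ← integral_Ioc_eq_integral_Ioo,
      ← intervalIntegral.integral_of_le ht.le, intervalIntegral.integral_const_mul,
      intervalIntegral.integral_mul_const, integral_pow]
    norm_num
  have v2 : ∫ z in t..(1 : ℝ), f z = Real.pi * ((1 - t) - (1 - t ^ 3) / 3) := by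
    rw [intervalIntegral.integral_of_le ht1, setIntegral_congr_fun measurableSet_Ioc e2,
      ← intervalIntegral.integral_of_le ht1, intervalIntegral.integral_const_mul,
      intervalIntegral.integral_sub (by simp)
        ((continuous_pow 2).intervalIntegrable _ _), integral_pow]
    norm_num
  rw [v1, v2]
  field_simp
  ring

/-- Completing e to an orthonormal basis gives volume-preserving coordinates in which the axis is
the first one. -/
theorem volume_spherical_cone {e : E3} (he : ‖e‖ = 1) {t : ℝ} (ht : 0 < t) (ht1 : t ≤ 1) :
    volume {x : E3 | ‖x‖ < 1 ∧ 0 < inner ℝ e x ∧ t * ‖x‖ ≤ inner ℝ e x} =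
      ENNReal.ofReal (2 * Real.pi / 3 * (1 - t)) := by
  obtain ⟨b, hb⟩ := Orthonormal.exists_orthonormalBasis_extension_of_card_eq (𝕜 := ℝ) (E := E3)
    (ι := Fin 3) (by simp) (v := fun _ => e) (s := {0}) (by
      constructor
      · intro i; simpa using he
      · intro i j hij
        exact absurd (Subsingleton.elim i j) hij)
  have hb0 : b 0 = e := hb 0 rfl
  have hmp := ((volume_preserving_piFinSuccAbove (fun _ : Fin 3 => ℝ) 0).comp
    (PiLp.volume_preserving_ofLp (Fin 3))).comp b.measurePreserving_repr
  rw [← volume_coordCone ht ht1,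
    ← hmp.measure_preimage (measurableSet_coordCone t).nullMeasurableSet]
  congr 1
  ext x
  have hn : ‖x‖ ^ 2 = b.repr x 0 ^ 2 + (b.repr x 1 ^ 2 + b.repr x 2 ^ 2) := by
    rw [← b.repr.norm_map x, EuclideanSpace.norm_sq_eq, Fin.sum_univ_three]
    simp [add_assoc]
  have hi : inner ℝ e x = b.repr x 0 := by rw [b.repr_apply_apply, hb0]
  simp only [coordCone, Set.mem_preimage, Set.mem_ofPred_eq, Function.comp_apply]
  change _ ↔ 0 < b.repr x 0 ∧ b.repr x 0 ^ 2 + (b.repr x 1 ^ 2 + b.repr x 2 ^ 2) < 1 ∧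
    t ^ 2 * (b.repr x 0 ^ 2 + (b.repr x 1 ^ 2 + b.repr x 2 ^ 2)) ≤ b.repr x 0 ^ 2
  rw [← hn, hi, ← mul_pow]
  constructor
  · rintro ⟨h1, h2, h3⟩
    exact ⟨h2, by nlinarith [norm_nonneg x], pow_le_pow_left₀ (by positivity) h3 2⟩
  · rintro ⟨h1, h2, h3⟩
    exact ⟨by nlinarith [norm_nonneg x], h1, le_of_sq_le_sq h3 h1.le⟩

-- The surface measure is defined as the dimension, here 3, times the volume of the cone over the
-- set. Caps with t > 0 suffice: at the horizon t is still rE / (rE + rMin).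
open scoped Pointwise in
theorem toSphere_cap {e : E3} (he : ‖e‖ = 1) {t : ℝ} (ht : 0 < t) (ht1 : t ≤ 1) :
    (volume : Measure E3).toSphere {y | t ≤ inner ℝ e (y : E3)} =
      ENNReal.ofReal (2 * Real.pi * (1 - t)) := by
  have hm : MeasurableSet {y : Metric.sphere (0 : E3) 1 | t ≤ inner ℝ e (y : E3)} :=
    measurableSet_le measurable_const
      (continuous_const.inner continuous_subtype_val).measurable
  rw [Measure.toSphere_apply' _ hm]
  have hset : Set.Ioo (0 : ℝ) 1 • ((↑) '' {y : Metric.sphere (0 : E3) 1 | t ≤ inner ℝ e (y : E3)} :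
      Set E3) = {x : E3 | ‖x‖ < 1 ∧ 0 < inner ℝ e x ∧ t * ‖x‖ ≤ inner ℝ e x} := by
    ext x
    simp only [Set.mem_smul, Set.mem_image, Set.mem_ofPred_eq, Subtype.exists, exists_and_right,
      exists_eq_right, mem_sphere_zero_iff_norm]
    constructor
    · rintro ⟨s, hs, y, ⟨hy, hty⟩, rfl⟩
      rw [norm_smul, hy, inner_smul_right, Real.norm_eq_abs, abs_of_pos hs.1]
      have := hs.1
      refine ⟨by simpa using hs.2, by nlinarith, by nlinarith⟩
    · rintro ⟨h1, h2, h3⟩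
      have hx : x ≠ 0 := by rintro rfl; simp at h2
      have hx' : 0 < ‖x‖ := norm_pos_iff.2 hx
      refine ⟨‖x‖, ⟨hx', h1⟩, ‖x‖⁻¹ • x, ⟨?_, ?_⟩, ?_⟩
      · rw [norm_smul, norm_inv, norm_norm, inv_mul_cancel₀ hx'.ne']
      · rw [inner_smul_right, inv_mul_eq_div, le_div_iff₀ hx']
        exact h3
      · rw [smul_smul, mul_inv_cancel₀ hx'.ne', one_smul]
  rw [hset, volume_spherical_cone he ht ht1]
  simp only [finrank_euclideanSpace, Fintype.card_fin]
  rw [show ((3 : ℕ) : ENNReal) = ENNReal.ofReal 3 by simp, ← ENNReal.ofReal_mul (by norm_num)]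
  congr 1
  ring

theorem toSphere_univ_E3 :
    (volume : Measure E3).toSphere Set.univ = ENNReal.ofReal (4 * Real.pi) := by
  rw [Measure.toSphere_apply_univ, EuclideanSpace.volume_ball_fin_three]
  simp only [finrank_euclideanSpace, Fintype.card_fin, ENNReal.ofReal_one, one_pow, one_mul]
  rw [show ((3 : ℕ) : ENNReal) = ENNReal.ofReal 3 by simp, ← ENNReal.ofReal_mul (by norm_num)]
  congr 1
  ring

/-! ### Distance from the user to one uniformly placed satellite. -/

theorem measurable_smul_sphere (ρ : ℝ) :
    Measurable (fun y : Metric.sphere (0 : E3) 1 => ρ • (y : E3)) :=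
  (continuous_subtype_val.const_smul ρ).measurable

instance isProbabilityMeasure_uniformSphere (ρ : ℝ) : IsProbabilityMeasure (uniformSphere ρ) := by
  have : IsProbabilityMeasure (cond (volume : Measure E3).toSphere Set.univ) :=
    cond_isProbabilityMeasure (by rw [toSphere_univ_E3]; simp [Real.pi_pos])
  exact Measure.isProbabilityMeasure_map (measurable_smul_sphere ρ).aemeasurable

theorem norm_eq_of_uniformSphere {ρ : ℝ} (hρ : 0 < ρ) : ∀ᵐ x ∂(uniformSphere ρ), ‖x‖ = ρ := by
  rw [uniformSphere, ae_map_iff (measurable_smul_sphere ρ).aemeasurable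
    (measurableSet_eq_fun (by fun_prop) (by fun_prop))]
  refine Eventually.of_forall fun y => ?_
  rw [norm_smul, norm_eq_of_mem_sphere, mul_one, Real.norm_eq_abs, abs_of_pos hρ]

/-- Law of the distance from the user to a uniformly placed satellite. -/
noncomputable def distLaw (q : Params) (u : E3) : Measure ℝ :=
  (uniformSphere (q.rE + q.rMin)).map (fun x => dist x u)

instance isProbabilityMeasure_distLaw (q : Params) (u : E3) :
    IsProbabilityMeasure (distLaw q u) :=
  Measure.isProbabilityMeasure_map (by fun_prop)

/-- Distribution function of the distance, valid above the horizon. -/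
noncomputable def Params.distCdf (q : Params) (r : ℝ) : ℝ :=
  (r ^ 2 - q.rMin ^ 2) / (4 * q.rE * (q.rE + q.rMin))

theorem Params.Admissible.rMax_sq {q : Params} (hq : q.Admissible) :
    q.rMax ^ 2 = 2 * q.rE * q.rMin + q.rMin ^ 2 := by
  have := hq.rE_pos
  have := hq.rMin_pos
  exact Real.sq_sqrt (by positivity)

theorem Params.Admissible.rMin_lt_rMax {q : Params} (hq : q.Admissible) : q.rMin < q.rMax := by
  have := hq.rE_pos
  have := hq.rMin_pos
  exact Real.lt_sqrt_of_sq_lt (by nlinarith [mul_pos hq.rE_pos hq.rMin_pos])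

theorem rMin_le_distLaw {q : Params} (hq : q.Admissible) {u : E3} (hu : ‖u‖ = q.rE) :
    ∀ᵐ r ∂(distLaw q u), q.rMin ≤ r := by
  have h1 := hq.rE_pos
  have h2 := hq.rMin_pos
  rw [distLaw, ae_map_iff (by fun_prop) measurableSet_Ici]
  filter_upwards [norm_eq_of_uniformSphere (by linarith : 0 < q.rE + q.rMin)] with x hx
  have := norm_sub_norm_le x u
  rw [dist_eq_norm]
  linarith

/-- The law of cosines turns the condition into a cap with threshold t, whose share of the sphere is
(1 - t)/2. The horizon bound on r keeps t positive, as `toSphere_cap` requires. -/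
theorem distLaw_Iic {q : Params} (hq : q.Admissible) {u : E3} (hu : ‖u‖ = q.rE) {r : ℝ}
    (hr : q.rMin ≤ r) (hr' : r ≤ q.rMax) :
    distLaw q u (Set.Iic r) = ENNReal.ofReal (q.distCdf r) := by
  have hE := hq.rE_pos
  have hm := hq.rMin_pos
  have hM := hq.rMax_sq
  set ρ := q.rE + q.rMin with hρ
  have hρ0 : 0 < ρ := by linarith
  set t := (ρ ^ 2 + q.rE ^ 2 - r ^ 2) / (2 * ρ * q.rE) with htdef
  have hr2 : r ^ 2 ≤ q.rMax ^ 2 := pow_le_pow_left₀ (by linarith) hr' 2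
  have ht : 0 < t := div_pos (by nlinarith) (by positivity)
  have ht1 : t ≤ 1 := by
    rw [htdef, div_le_one (by positivity)]
    nlinarith
  have he : ‖q.rE⁻¹ • u‖ = 1 := by
    rw [norm_smul, hu, norm_inv, Real.norm_eq_abs, abs_of_pos hE, inv_mul_cancel₀ hE.ne']
  rw [distLaw, Measure.map_apply (by fun_prop) measurableSet_Iic, uniformSphere,
    Measure.map_apply (measurable_smul_sphere _)
      ((by fun_prop : Measurable fun x : E3 => dist x u) measurableSet_Iic)]
  have hset : (fun y : Metric.sphere (0 : E3) 1 => ρ • (y : E3)) ⁻¹'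
      ((fun x => dist x u) ⁻¹' Set.Iic r) =
      {y : Metric.sphere (0 : E3) 1 | t ≤ inner ℝ (q.rE⁻¹ • u) (y : E3)} := by
    ext y
    have hy : ‖(y : E3)‖ = 1 := norm_eq_of_mem_sphere y
    simp only [Set.mem_preimage, Set.mem_Iic, Set.mem_ofPred_eq]
    rw [dist_eq_norm, ← abs_of_nonneg (norm_nonneg (ρ • (y : E3) - u)),
      ← abs_of_nonneg (by linarith : 0 ≤ r), ← sq_le_sq, norm_sub_sq_real, norm_smul, hy, hu,
      real_inner_smul_left, real_inner_smul_left, real_inner_comm u, Real.norm_eq_abs, mul_one,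
      sq_abs, htdef, inv_mul_eq_div, div_le_div_iff₀ (by positivity) hE]
    constructor
    · intro h
      nlinarith
    · intro h
      have : (ρ ^ 2 + q.rE ^ 2 - r ^ 2) ≤ inner ℝ u (y : E3) * (2 * ρ) :=
        le_of_mul_le_mul_right (by linarith) hE
      linarith
  rw [hset, cond_apply MeasurableSet.univ, Set.univ_inter, toSphere_cap he ht ht1,
    toSphere_univ_E3, mul_comm, ← div_eq_mul_inv,
    ← ENNReal.ofReal_div_of_pos (by positivity)]
  congr 1
  rw [Params.distCdf, htdef, ← hρ]
  have : q.rMin = ρ - q.rE := by rw [hρ]; ring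
  rw [this]
  have := Real.pi_pos
  field_simp
  ring

theorem distCdf_rMin (q : Params) : q.distCdf q.rMin = 0 := by simp [Params.distCdf]

/-- Density of the distance, valid above the horizon. -/
noncomputable def Params.distPdf (q : Params) (r : ℝ) : ℝ := r / (2 * q.rE * (q.rE + q.rMin))

theorem integral_distPdf (q : Params) (a b : ℝ) :
    ∫ r in a..b, q.distPdf r = q.distCdf b - q.distCdf a := by
  simp only [Params.distPdf, Params.distCdf]
  rw [intervalIntegral.integral_div, integral_id]
  field_simp
  ring

/-- Above the horizon the distance has a density. -/
theorem distLaw_restrict_Iic {q : Params} (hq : q.Admissible) {u : E3} (hu : ‖u‖ = q.rE) :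
    (distLaw q u).restrict (Set.Iic q.rMax) =
      (volume.restrict (Set.Ioo q.rMin q.rMax)).withDensity
        (fun r => ENNReal.ofReal (q.distPdf r)) := by
  have hE := hq.rE_pos
  have hm := hq.rMin_pos
  have hlt := hq.rMin_lt_rMax
  refine Measure.ext_of_Iic _ _ fun a => ?_
  rw [restrict_Ioo_eq_restrict_Ioc, Measure.restrict_apply measurableSet_Iic, Set.Iic_inter_Iic,
    withDensity_apply _ measurableSet_Iic, Measure.restrict_restrict measurableSet_Iic,
    Set.inter_comm, Set.Ioc_inter_Iic]
  set b := min q.rMax a with hb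
  rw [inf_comm a]
  rcases lt_or_ge b q.rMin with h | h
  · rw [Set.Ioc_eq_empty (by simpa using h.le)]
    simp only [Measure.restrict_empty, lintegral_zero_measure]
    refine measure_mono_null (t := {r | ¬ q.rMin ≤ r}) ?_ (rMin_le_distLaw hq hu)
    intro r hr
    simp only [Set.mem_Iic, Set.mem_ofPred_eq, not_le] at hr ⊢
    exact lt_of_le_of_lt hr h
  · change distLaw q u (Set.Iic b) = _
    have hcont : Continuous q.distPdf := by unfold Params.distPdf; fun_prop
    rw [distLaw_Iic hq hu h (min_le_left _ _), ← ofReal_integral_eq_lintegral_ofReal,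
      ← intervalIntegral.integral_of_le h, integral_distPdf, distCdf_rMin, sub_zero]
    · exact hcont.integrableOn_Icc.mono_set Set.Ioc_subset_Icc_self
    · filter_upwards [ae_restrict_mem measurableSet_Ioc] with r hr
      have : 0 < r := hm.trans hr.1
      simp only [Pi.zero_apply, Params.distPdf]
      positivity

/-! ### The minimum of independent distances and the index that attains it. -/

/-- Fubini with the s-th coordinate singled out: once it is fixed, the others remain independent.
The sets `T j` vary with j to accommodate both tie-breaking and the distinction between channels. -/
theorem pi_setOf_mem_and_forall_ne (ν : Measure ℝ) [IsProbabilityMeasure ν] {n : ℕ} (s : Fin n)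
    {B : Set ℝ} (hB : MeasurableSet B) (T : Fin n → ℝ → Set ℝ)
    (hT : ∀ j, MeasurableSet {p : ℝ × ℝ | p.2 ∈ T j p.1}) :
    Measure.pi (fun _ : Fin n => ν) {d | d s ∈ B ∧ ∀ j, j ≠ s → d j ∈ T j (d s)} =
      ∫⁻ r in B, ∏ j ∈ ({s}ᶜ : Finset (Fin n)), ν (T j r) ∂ν := by
  cases n with
  | zero => exact s.elim0
  | succ n =>
    set S : Set (ℝ × (Fin n → ℝ)) :=
      {p | p.1 ∈ B ∧ ∀ j, p.2 j ∈ T (s.succAbove j) p.1} with hS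
    have hSm : MeasurableSet S := by
      refine (measurable_fst hB).inter ?_
      have : {p : ℝ × (Fin n → ℝ) | ∀ j, p.2 j ∈ T (s.succAbove j) p.1} =
          ⋂ j, (fun p : ℝ × (Fin n → ℝ) => (p.1, p.2 j)) ⁻¹'
            {p : ℝ × ℝ | p.2 ∈ T (s.succAbove j) p.1} := by
        ext p; simp
      change MeasurableSet {p : ℝ × (Fin n → ℝ) | ∀ j, p.2 j ∈ T (s.succAbove j) p.1}
      rw [this]
      exact MeasurableSet.iInter fun j =>
        (measurable_fst.prodMk ((measurable_pi_apply j).comp measurable_snd)) (hT _)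
    have hpre : {d : Fin (n + 1) → ℝ | d s ∈ B ∧ ∀ j, j ≠ s → d j ∈ T j (d s)} =
        MeasurableEquiv.piFinSuccAbove (fun _ => ℝ) s ⁻¹' S := by
      ext d
      simp only [hS, Set.mem_ofPred_eq, Set.mem_preimage]
      change _ ↔ d s ∈ B ∧ ∀ j, d (s.succAbove j) ∈ T (s.succAbove j) (d s)
      rw [Fin.forall_iff_succAbove s]
      simp [Fin.succAbove_ne]
    rw [hpre, (measurePreserving_piFinSuccAbove (fun _ : Fin (n + 1) => ν) s).measure_preimage
      hSm.nullMeasurableSet, Measure.prod_apply hSm, ← lintegral_indicator hB]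
    refine lintegral_congr fun r => ?_
    by_cases hr : r ∈ B
    · rw [Set.indicator_of_mem hr, ← Fin.image_succAbove_univ,
        Finset.prod_image (fun _ _ _ _ h => Fin.succAbove_right_injective h), ← Measure.pi_pi]
      congr 1
      ext v
      simp [hS, hr]
    · rw [Set.indicator_of_notMem hr]
      convert! measure_empty (μ := Measure.pi fun _ : Fin n => ν)
      ext v
      simp [hS, hr]

theorem measurableSet_isServing {n : ℕ} (s : Fin n) :
    MeasurableSet {d : Fin n → ℝ | IsServing d s} := by
  have h1 : ∀ j, MeasurableSet {d : Fin n → ℝ | d s ≤ d j} := fun j =>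
    measurableSet_le (measurable_pi_apply s) (measurable_pi_apply j)
  have h2 : ∀ j, MeasurableSet {d : Fin n → ℝ | j < s → d s < d j} := by
    intro j
    by_cases h : j < s
    · simpa [h] using measurableSet_lt (measurable_pi_apply (X := fun _ : Fin n => ℝ) s)
        (measurable_pi_apply j)
    · simp [h]
  have : {d : Fin n → ℝ | IsServing d s} =
      (⋂ j, {d | d s ≤ d j}) ∩ ⋂ j, {d | j < s → d s < d j} := by
    ext d; simp [IsServing]
  rw [this]
  exact (MeasurableSet.iInter h1).inter (MeasurableSet.iInter h2)

/-- Probability that satellite `s` is the serving one, that its distance lies in `B`, and that the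
satellites in `J` are beyond distance `M`. -/
theorem pi_isServing (ν : Measure ℝ) [IsProbabilityMeasure ν] {n : ℕ} (s : Fin n) {M : ℝ}
    (hν : ∀ r ≤ M, ν {r} = 0) {B : Set ℝ} (hB : MeasurableSet B) (hBM : B ⊆ Set.Iic M)
    {J : Finset (Fin n)} (hJ : s ∉ J) :
    Measure.pi (fun _ : Fin n => ν) {d | IsServing d s ∧ d s ∈ B ∧ ∀ j ∈ J, M < d j} =
      ∫⁻ r in B, ν (Set.Ioi M) ^ J.card * ν (Set.Ioi r) ^ (n - 1 - J.card) ∂ν := by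
  -- What is required of the j-th distance when s is at distance r: not nearer, strictly farther if
  -- j would win a tie, and beyond M if j is in J.
  set T : Fin n → ℝ → Set ℝ := fun j r =>
    {x | r ≤ x ∧ (j < s → r < x) ∧ (j ∈ J → M < x)} with hT
  have hTm : ∀ j, MeasurableSet {p : ℝ × ℝ | p.2 ∈ T j p.1} := by
    intro j
    have e1 : MeasurableSet {p : ℝ × ℝ | p.1 ≤ p.2} := measurableSet_le measurable_fst measurable_snd
    have e2 : MeasurableSet {p : ℝ × ℝ | j < s → p.1 < p.2} := by
      by_cases h : j < s
      · simpa [h] using measurableSet_lt (measurable_fst (α := ℝ) (β := ℝ)) measurable_snd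
      · simp [h]
    have e3 : MeasurableSet {p : ℝ × ℝ | j ∈ J → M < p.2} := by
      by_cases h : j ∈ J
      · simpa [h] using measurableSet_lt measurable_const (measurable_snd (α := ℝ) (β := ℝ))
      · simp [h]
    exact e1.inter (e2.inter e3)
  have hset : {d : Fin n → ℝ | IsServing d s ∧ d s ∈ B ∧ ∀ j ∈ J, M < d j} =
      {d | d s ∈ B ∧ ∀ j, j ≠ s → d j ∈ T j (d s)} := by
    ext d
    simp only [Set.mem_ofPred_eq, hT, IsServing]
    constructor
    · rintro ⟨⟨h1, h2⟩, h3, h4⟩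
      exact ⟨h3, fun j _ => ⟨h1 j, h2 j, h4 j⟩⟩
    · rintro ⟨h1, h2⟩
      refine ⟨⟨fun j => ?_, fun j hj => (h2 j hj.ne).2.1 hj⟩, h1,
        fun j hj => (h2 j (by rintro rfl; exact hJ hj)).2.2 hj⟩
      by_cases h : j = s
      · rw [h]
      · exact (h2 j h).1
  rw [hset, pi_setOf_mem_and_forall_ne ν s hB T hTm]
  refine setLIntegral_congr_fun hB fun r hr => ?_
  have hrM : r ≤ M := hBM hr
  have hTJ : ∀ j ∈ J, ν (T j r) = ν (Set.Ioi M) := by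
    intro j hj
    congr 1
    ext x
    simp only [hT, hj, Set.mem_ofPred_eq, Set.mem_Ioi, forall_const]
    exact ⟨fun h => h.2.2, fun h => ⟨hrM.trans h.le, fun _ => hrM.trans_lt h, h⟩⟩
  -- The two sets differ at most by the point r, which is null because r ≤ M; the tie rule leaves no
  -- trace in the result.
  have hTn : ∀ j ∉ J, ν (T j r) = ν (Set.Ioi r) := by
    intro j hj
    refine le_antisymm ?_ (measure_mono ?_)
    · calc ν (T j r) ≤ ν (Set.Ioi r ∪ {r}) := by
            refine measure_mono fun x hx => ?_
            rcases hx.1.lt_or_eq with h | h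
            · exact Or.inl h
            · exact Or.inr h.symm
        _ ≤ ν (Set.Ioi r) + ν {r} := measure_union_le _ _
        _ = ν (Set.Ioi r) := by rw [hν r hrM, add_zero]
    · intro x hx
      simp only [hT, hj, Set.mem_ofPred_eq, Set.mem_Ioi, false_imp_iff, and_true] at hx ⊢
      exact ⟨hx.le, fun _ => hx⟩
  have hsub : J ⊆ ({s}ᶜ : Finset (Fin n)) := by
    intro j hj
    simp only [Finset.mem_compl, Finset.mem_singleton]
    rintro rfl
    exact hJ hj
  rw [← Finset.prod_sdiff hsub, Finset.prod_congr rfl hTJ, Finset.prod_const,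
    Finset.prod_congr rfl (fun j hj => hTn j (Finset.mem_sdiff.1 hj).2), Finset.prod_const,
    Finset.card_sdiff_of_subset hsub, Finset.card_compl, Finset.card_singleton, Fintype.card_fin,
    mul_comm]

theorem IsServing.unique {n : ℕ} {d : Fin n → ℝ} {s s' : Fin n} (h : IsServing d s)
    (h' : IsServing d s') : s = s' := by
  rcases lt_trichotomy s s' with hlt | heq | hlt
  · exact absurd (h'.2 s hlt) (not_lt.2 (h.1 s'))
  · exact heq
  · exact absurd (h.2 s' hlt) (not_lt.2 (h'.1 s))

theorem exists_isServing {n : ℕ} (hn : 0 < n) (d : Fin n → ℝ) : ∃ s, IsServing d s := by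
  have : Nonempty (Fin n) := ⟨⟨0, hn⟩⟩
  have hne : {s : Fin n | ∀ j, d s ≤ d j}.Nonempty := Finite.exists_min d
  obtain ⟨s, hs, hmin⟩ := WellFounded.has_min (wellFounded_lt (α := Fin n)) _ hne
  refine ⟨s, hs, fun j hj => ?_⟩
  by_contra hle
  exact hmin j (fun k => (not_lt.1 hle).trans (hs k)) hj

theorem IsServing.iInf_eq {n : ℕ} {d : Fin n → ℝ} {s : Fin n} (h : IsServing d s) :
    ⨅ i, d i = d s := by
  have : Nonempty (Fin n) := ⟨s⟩
  exact le_antisymm (ciInf_le (Set.finite_range d).bddBelow s) (le_ciInf h.1)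

theorem interferers_eq_empty_iff {q : Params} {d : Fin q.N → ℝ} {a : Fin q.N → Fin q.K}
    {s : Fin q.N} (h : IsServing d s) :
    interferers q d a = ∅ ↔ ∀ j, j ≠ s → a j = a s → q.rMax < d j := by
  classical
  unfold interferers
  rw [Finset.filter_eq_empty_iff]
  constructor
  · intro H j hj haj
    by_contra hle
    exact H (Finset.mem_univ j) ⟨not_lt.1 hle, s, h, hj, haj⟩
  · rintro H j - ⟨hle, s', hs', hne, haj⟩
    obtain rfl := h.unique hs'
    exact absurd (H j hne haj) (not_lt.2 hle)

/-- Decompose by the serving index. The pieces are disjoint and contribute equally, since every `J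
s` has m elements, hence the factor n. Empty `J` gives the law of the minimum; co-channel sets give
the event of no interference. -/
theorem pi_iInf_mem (ν : Measure ℝ) [IsProbabilityMeasure ν] {n : ℕ} (hn : 0 < n) {M : ℝ}
    (hν : ∀ r ≤ M, ν {r} = 0) {B : Set ℝ} (hB : MeasurableSet B) (hBM : B ⊆ Set.Iic M)
    (J : Fin n → Finset (Fin n)) (hJ : ∀ s, s ∉ J s) {m : ℕ} (hm : ∀ s, (J s).card = m)
    (E : Set (Fin n → ℝ))
    (hE : ∀ d s, IsServing d s → (d ∈ E ↔ ∀ j ∈ J s, M < d j)) :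
    Measure.pi (fun _ : Fin n => ν) {d | ⨅ i, d i ∈ B ∧ d ∈ E} =
      ∫⁻ r in B, n * (ν (Set.Ioi M) ^ m * ν (Set.Ioi r) ^ (n - 1 - m)) ∂ν := by
  have hset : {d : Fin n → ℝ | ⨅ i, d i ∈ B ∧ d ∈ E} =
      ⋃ s, {d | IsServing d s ∧ d s ∈ B ∧ ∀ j ∈ J s, M < d j} := by
    ext d
    simp only [Set.mem_ofPred_eq, Set.mem_iUnion]
    constructor
    · rintro ⟨h1, h2⟩
      obtain ⟨s, hs⟩ := exists_isServing hn d
      exact ⟨s, hs, hs.iInf_eq ▸ h1, (hE d s hs).1 h2⟩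
    · rintro ⟨s, hs, h1, h2⟩
      exact ⟨hs.iInf_eq ▸ h1, (hE d s hs).2 h2⟩
  have hmeas : ∀ s, MeasurableSet
      {d : Fin n → ℝ | IsServing d s ∧ d s ∈ B ∧ ∀ j ∈ J s, M < d j} := by
    intro s
    refine (measurableSet_isServing s).inter ((measurable_pi_apply s hB).inter ?_)
    have : {d : Fin n → ℝ | ∀ j ∈ J s, M < d j} = ⋂ j ∈ J s, {d | M < d j} := by
      ext d; simp
    change MeasurableSet {d : Fin n → ℝ | ∀ j ∈ J s, M < d j}
    rw [this]
    exact Finset.measurableSet_biInter _ fun j _ =>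
      measurableSet_lt measurable_const (measurable_pi_apply j)
  rw [hset, measure_iUnion _ hmeas, tsum_fintype]
  · simp_rw [pi_isServing ν _ hν hB hBM (hJ _), hm]
    rw [Finset.sum_const, Finset.card_univ, Fintype.card_fin, nsmul_eq_mul,
      lintegral_const_mul' _ _ (ENNReal.natCast_ne_top n)]
  · intro s s' hne
    refine Set.disjoint_left.2 fun d hd hd' => hne (hd.1.unique hd'.1)

theorem measurableSet_mem_interferers (q : Params) (i : Fin q.N) :
    MeasurableSet {p : (Fin q.N → ℝ) × (Fin q.N → Fin q.K) | i ∈ interferers q p.1 p.2} := by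
  classical
  have : {p : (Fin q.N → ℝ) × (Fin q.N → Fin q.K) | i ∈ interferers q p.1 p.2} =
      {p | p.1 i ≤ q.rMax} ∩ ⋃ s, (Prod.fst ⁻¹' {d | IsServing d s}) ∩
        (Prod.snd ⁻¹' {a : Fin q.N → Fin q.K | i ≠ s ∧ a i = a s}) := by
    ext p
    simp [interferers]
  rw [this]
  refine (measurableSet_le ((measurable_pi_apply i).comp measurable_fst) measurable_const).inter
    (MeasurableSet.iUnion fun s => (measurable_fst (measurableSet_isServing s)).inter
      (measurable_snd (Set.toFinite _).measurableSet))

theorem NI_eq_zero_of_rMax_lt {q : Params} {Ω : Type*} {u : E3} {X : Fin q.N → Ω → E3}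
    {c : Ω → Fin q.N → Fin q.K} {w : Ω} (h : q.rMax < R0 q u X w) : NI q u X c w = 0 := by
  unfold NI
  rw [Finset.card_eq_zero, Finset.eq_empty_iff_forall_notMem]
  intro i hi
  simp only [interferers, Finset.mem_filter] at hi
  have h1 : R0 q u X w ≤ dists q u X w i := ciInf_le (Set.finite_range _).bddBelow i
  linarith [hi.2.1]

/-! ### Measurability of the network quantities and reduction to a product measure. -/

section Network

variable {q : Params} {Ω : Type*} [MeasurableSpace Ω] {P : Measure Ω} {u : E3}
  {X : Fin q.N → Ω → E3} {c : Ω → Fin q.N → Fin q.K} {G : Fin q.N → Ω → ℝ}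

theorem measurable_dists (hX : ∀ i, Measurable (X i)) : Measurable (dists q u X) :=
  measurable_pi_lambda _ fun i => (hX i).dist measurable_const

theorem measurable_R0 (hX : ∀ i, Measurable (X i)) : Measurable (R0 q u X) :=
  Measurable.iInf fun i => (measurable_pi_apply i).comp (measurable_dists hX)

theorem measurableSet_mem_interferers_dists (hX : ∀ i, Measurable (X i)) (hc : Measurable c)
    (i : Fin q.N) : MeasurableSet {w | i ∈ interferers q (dists q u X w) (c w)} :=
  ((measurable_dists hX).prodMk hc) (measurableSet_mem_interferers q i)

theorem measurable_NI (hX : ∀ i, Measurable (X i)) (hc : Measurable c) :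
    Measurable (NI q u X c) := by
  classical
  have : NI q u X c = fun w =>
      ∑ i, if i ∈ interferers q (dists q u X w) (c w) then 1 else 0 := by
    ext w
    simp [NI]
  rw [this]
  exact Finset.measurable_sum _ fun i _ => Measurable.ite
    (measurableSet_mem_interferers_dists hX hc i) measurable_const measurable_const

theorem measurable_interference (hX : ∀ i, Measurable (X i)) (hc : Measurable c)
    (hG : ∀ i, Measurable (G i)) : Measurable (interference q u X c G) := by
  classical
  have : interference q u X c G = fun w => ∑ i,
      if i ∈ interferers q (dists q u X w) (c w) then
        q.pI * G i w * (dists q u X w i) ^ (-q.alpha) else 0 := by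
    ext w
    simp [interference]
  rw [this]
  refine Finset.measurable_sum _ fun i _ => Measurable.ite
    (measurableSet_mem_interferers_dists hX hc i) ?_ measurable_const
  exact ((hG i).const_mul _).mul
    (((measurable_pi_apply i).comp (measurable_dists hX)).pow_const _)

theorem measurable_gain (q : Params) (g : ServingGain) : Measurable (g.gain q) := by
  cases g with
  | always => exact measurable_const
  | aboveHorizon => exact Measurable.ite measurableSet_Iic measurable_const measurable_const

theorem measurable_sinr (hX : ∀ i, Measurable (X i)) (hc : Measurable c)
    (hG : ∀ i, Measurable (G i)) (g : ServingGain) : Measurable (sinr q u X c G g) := by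
  have h0 := measurable_R0 (u := u) hX
  exact (((measurable_gain q g).comp h0).const_mul q.pS |>.mul (h0.pow_const _)).div
    ((measurable_interference hX hc hG).add_const _)

theorem map_dists (hnet : IsNetwork q P u X c G) :
    P.map (dists q u X) = Measure.pi fun _ : Fin q.N => distLaw q u := by
  have h := (hnet.indep_X.comp (fun _ x => dist x u) (fun _ => by fun_prop)).map_fun_eq_pi_map
    (fun i => ((hnet.measurable_X i).dist measurable_const).aemeasurable)
  change P.map (fun w i => dist (X i w) u) = _
  rw [h]
  congr 1
  ext1 i
  rw [distLaw, ← hnet.law_X i, Measure.map_map (by fun_prop) (hnet.measurable_X i)]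
  rfl

/-- By independence the assignment may be frozen. If every balanced assignment yields the same
probability, averaging over assignments changes nothing. -/
theorem measure_dists_assignment [IsProbabilityMeasure P] (hnet : IsNetwork q P u X c G)
    {S : Set ((Fin q.N → ℝ) × (Fin q.N → Fin q.K))} (hS : MeasurableSet S) {v : ENNReal}
    (hv : ∀ a ∈ balanced q, Measure.pi (fun _ : Fin q.N => distLaw q u) {d | (d, a) ∈ S} = v) :
    P {w | (dists q u X w, c w) ∈ S} = v := by
  have hind : IndepFun (dists q u X) c P :=
    hnet.indep_c.comp (φ := fun p : (Fin q.N → E3) × (Fin q.N → ℝ) => fun i => dist (p.1 i) u)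
      (ψ := id) (by fun_prop) measurable_id
  have hprod := hind.map_prod_eq_prod_map_map (measurable_dists hnet.measurable_X).aemeasurable
    hnet.measurable_c.aemeasurable
  have h1 : P {w | (dists q u X w, c w) ∈ S} =
      P.map (fun w => (dists q u X w, c w)) S :=
    (Measure.map_apply ((measurable_dists hnet.measurable_X).prodMk hnet.measurable_c) hS).symm
  -- Total mass one comes from the push-forward, so no balanced assignment has to be exhibited.
  have hpc : IsProbabilityMeasure (P.map c) :=
    Measure.isProbabilityMeasure_map hnet.measurable_c.aemeasurable
  rw [h1, hprod, map_dists hnet, Measure.prod_apply_symm hS]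
  have hae : ∀ᵐ a ∂(P.map c), Measure.pi (fun _ : Fin q.N => distLaw q u)
      ((fun x => (x, a)) ⁻¹' S) = v := by
    rw [hnet.law_c]
    filter_upwards [ae_cond_mem (Set.toFinite (balanced q)).measurableSet] with a ha
    exact hv a ha
  rw [lintegral_congr_ae hae, lintegral_const, measure_univ, mul_one]

end Network

/-! ### Algebra of the distribution function and of P_0. -/

section DistanceLaw

variable {q : Params} {u : E3}

theorem distLaw_singleton (hq : q.Admissible) (hu : ‖u‖ = q.rE) {r : ℝ} (hr : r ≤ q.rMax) :
    distLaw q u {r} = 0 := by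
  have h : (distLaw q u).restrict (Set.Iic q.rMax) {r} = distLaw q u {r} := by
    rw [Measure.restrict_apply (measurableSet_singleton r)]
    congr 1
    ext x
    simp only [Set.mem_inter_iff, Set.mem_singleton_iff, Set.mem_Iic, and_iff_left_iff_imp]
    rintro rfl
    exact hr
  rw [← h, distLaw_restrict_Iic hq hu]
  exact (withDensity_absolutelyContinuous _ _) (measure_singleton r)

theorem distCdf_lt_one (hq : q.Admissible) {r : ℝ} (hr0 : 0 ≤ r) (hr : r ≤ q.rMax) :
    q.distCdf r < 1 := by
  have hE := hq.rE_pos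
  have hm := hq.rMin_pos
  have hM := hq.rMax_sq
  have hr2 : r ^ 2 ≤ q.rMax ^ 2 := pow_le_pow_left₀ hr0 hr 2
  rw [Params.distCdf, div_lt_one (by positivity)]
  nlinarith [mul_pos hE hm]

theorem distCdf_nonneg (hq : q.Admissible) {r : ℝ} (hr : q.rMin ≤ r) : 0 ≤ q.distCdf r := by
  have hE := hq.rE_pos
  have hm := hq.rMin_pos
  have : q.rMin ^ 2 ≤ r ^ 2 := pow_le_pow_left₀ hm.le hr 2
  exact div_nonneg (by linarith) (by positivity)

theorem distLaw_Ioi (hq : q.Admissible) (hu : ‖u‖ = q.rE) {r : ℝ} (hr : q.rMin ≤ r)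
    (hr' : r ≤ q.rMax) : distLaw q u (Set.Ioi r) = ENNReal.ofReal (1 - q.distCdf r) := by
  rw [← Set.compl_Iic, prob_compl_eq_one_sub measurableSet_Iic, distLaw_Iic hq hu hr hr',
    ENNReal.ofReal_sub _ (distCdf_nonneg hq hr), ENNReal.ofReal_one]

/-- Identifies `Params.probInterf` as the conditional probability (F(r_max) - F(r)) / (1 - F(r)):
numerator and denominator are these two differences times 2(rE + rMin). -/
theorem one_sub_probInterf (hq : q.Admissible) {r : ℝ} (hr0 : 0 ≤ r) (hr : r ≤ q.rMax) :
    1 - q.probInterf r = (1 - q.distCdf q.rMax) / (1 - q.distCdf r) := by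
  have hE := hq.rE_pos
  have hm := hq.rMin_pos
  have hM := hq.rMax_sq
  have hlt := distCdf_lt_one hq hr0 hr
  have hr2 : r ^ 2 ≤ q.rMax ^ 2 := pow_le_pow_left₀ hr0 hr 2
  have h1 : (1 - q.distCdf r) ≠ 0 := by linarith
  have h2 : 2 * (q.rE + q.rMin) - (r ^ 2 - q.rMin ^ 2) / (2 * q.rE) =
      2 * (q.rE + q.rMin) * (1 - q.distCdf r) := by
    rw [Params.distCdf]
    field_simp
    ring
  have h3 : q.rMin - (r ^ 2 - q.rMin ^ 2) / (2 * q.rE) =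
      2 * (q.rE + q.rMin) * (q.distCdf q.rMax - q.distCdf r) := by
    rw [Params.distCdf, Params.distCdf, hM]
    field_simp
    ring
  rw [Params.probInterf, h2, h3]
  have h4 : q.rE + q.rMin ≠ 0 := by positivity
  field_simp
  ring

theorem div_le_self_admissible (hq : q.Admissible) :
    0 < q.N / q.K ∧ q.N / q.K ≤ q.N :=
  ⟨Nat.div_pos (Nat.le_of_dvd hq.N_pos hq.K_dvd) hq.K_pos, Nat.div_le_self _ _⟩

/-- Bayes' rule for densities, up to the factor N: of the N - 1 other satellites, N/K - 1 share the
channel and must lie beyond the horizon, the rest only beyond r. -/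
theorem P0_mul_pow (hq : q.Admissible) {r : ℝ} (hr0 : 0 ≤ r) (hr : r ≤ q.rMax) :
    q.P0 r * (1 - q.distCdf r) ^ (q.N - 1) =
      (1 - q.distCdf q.rMax) ^ (q.N / q.K - 1) *
        (1 - q.distCdf r) ^ (q.N - 1 - (q.N / q.K - 1)) := by
  obtain ⟨h1, h2⟩ := div_le_self_admissible hq
  have hlt := distCdf_lt_one hq hr0 hr
  have hne : (1 - q.distCdf r) ≠ 0 := by linarith
  have he : q.N - 1 = (q.N / q.K - 1) + (q.N - 1 - (q.N / q.K - 1)) := by omega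
  rw [Params.P0, if_pos hr, one_sub_probInterf hq hr0 hr]
  conv_lhs => rw [he, pow_add]
  rw [div_pow]
  field_simp

theorem probInterf_nonneg (hq : q.Admissible) {r : ℝ} (hr0 : 0 ≤ r) (hr : r ≤ q.rMax) :
    0 ≤ 1 - q.probInterf r := by
  rw [one_sub_probInterf hq hr0 hr]
  have h1 := distCdf_lt_one hq hr0 hr
  have h2 := distCdf_lt_one hq (hr0.trans hr) le_rfl
  exact div_nonneg (by linarith) (by linarith)

theorem distCdf_lt_distCdf (hq : q.Admissible) {r s : ℝ} (hr0 : 0 ≤ r) (hr : r < s) :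
    q.distCdf r < q.distCdf s := by
  have hE := hq.rE_pos
  have hm := hq.rMin_pos
  have : r ^ 2 < s ^ 2 := pow_lt_pow_left₀ hr hr0 two_ne_zero
  exact div_lt_div_of_pos_right (by linarith) (by positivity)

theorem P0_nonneg (hq : q.Admissible) {r : ℝ} (hr0 : 0 ≤ r) : 0 ≤ q.P0 r := by
  unfold Params.P0
  split_ifs with h
  · exact pow_nonneg (probInterf_nonneg hq hr0 h) _
  · exact zero_le_one

theorem P0_le_one (hq : q.Admissible) {r : ℝ} (hr0 : 0 ≤ r) : q.P0 r ≤ 1 := by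
  unfold Params.P0
  split_ifs with h
  · refine pow_le_one₀ (probInterf_nonneg hq hr0 h) ?_
    rw [one_sub_probInterf hq hr0 h]
    have h1 := distCdf_lt_one hq hr0 h
    refine div_le_one_of_le₀ ?_ (by linarith)
    rcases h.lt_or_eq with h' | h'
    · linarith [distCdf_lt_distCdf hq hr0 h']
    · rw [h']
  · exact le_rfl

/-- Strictness makes conditioning on interference nondegenerate at every serving distance short of
the horizon. K < N and K ∣ N force N/K ≥ 2, so the exponent is nonzero. -/
theorem P0_lt_one (hq : q.Admissible) (hKN : q.K < q.N) {r : ℝ} (hr0 : 0 ≤ r) (hr : r < q.rMax) :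
    q.P0 r < 1 := by
  have h1 := distCdf_lt_one hq hr0 hr.le
  have h2 := distCdf_lt_distCdf hq hr0 hr
  rw [Params.P0, if_pos hr.le]
  refine pow_lt_one₀ (probInterf_nonneg hq hr0 hr.le) ?_ ?_
  · rw [one_sub_probInterf hq hr0 hr.le, div_lt_one (by linarith)]
    linarith
  · obtain ⟨k, hk⟩ := hq.K_dvd
    rw [hk, Nat.mul_div_cancel_left _ hq.K_pos]
    rw [hk] at hKN
    have : 1 < k := by
      by_contra h
      have : k ≤ 1 := by omega
      nlinarith
    omega

theorem measurable_P0 (q : Params) : Measurable q.P0 := by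
  unfold Params.P0 Params.probInterf
  exact Measurable.ite measurableSet_Iic (by fun_prop) measurable_const

end DistanceLaw

/-! ### Law of the serving distance, alone and jointly with the absence of interference. -/

section ServingDistance

variable {q : Params} {Ω : Type*} [MeasurableSpace Ω] {P : Measure Ω}
  {u : E3} {X : Fin q.N → Ω → E3} {c : Ω → Fin q.N → Fin q.K} {G : Fin q.N → Ω → ℝ}

/-- Weight of the serving distance relative to the law of a single distance. -/
noncomputable def Params.minWeight (q : Params) (r : ℝ) : ℝ := q.N * (1 - q.distCdf r) ^ (q.N - 1)

theorem measurable_iInf_mem {B : Set ℝ} (hB : MeasurableSet B) (n : ℕ) :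
    MeasurableSet {d : Fin n → ℝ | ⨅ i, d i ∈ B} :=
  (Measurable.iInf fun i => measurable_pi_apply (X := fun _ : Fin n => ℝ) i) hB

theorem measure_R0_mem (hq : q.Admissible) (hnet : IsNetwork q P u X c G) {B : Set ℝ}
    (hB : MeasurableSet B) (hBM : B ⊆ Set.Iic q.rMax) :
    P (R0 q u X ⁻¹' B) = ∫⁻ r in B, ENNReal.ofReal (q.minWeight r) ∂(distLaw q u) := by
  have hu := hnet.norm_user
  have h := pi_iInf_mem (distLaw q u) hq.N_pos (fun r hr => distLaw_singleton hq hu hr) hB hBM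
    (fun _ => ∅) (by simp) (m := 0) (by simp) Set.univ (by simp)
  rw [← map_dists hnet] at h
  simp only [Set.mem_univ, and_true] at h
  rw [Measure.map_apply (measurable_dists hnet.measurable_X) (measurable_iInf_mem hB _)] at h
  change P (R0 q u X ⁻¹' B) = _ at h
  rw [h]
  refine lintegral_congr_ae ?_
  filter_upwards [ae_restrict_mem hB, ae_restrict_of_ae (rMin_le_distLaw hq hu)] with r hr hr'
  have hlt := distCdf_lt_one hq (hq.rMin_pos.le.trans hr') (hBM hr)
  rw [distLaw_Ioi hq hu hr' (hBM hr), pow_zero, one_mul, Nat.sub_zero, Params.minWeight,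
    ENNReal.ofReal_mul (by positivity), ENNReal.ofReal_natCast,
    ENNReal.ofReal_pow (by linarith)]

theorem card_filter_channel {a : Fin q.N → Fin q.K} (ha : a ∈ balanced q) (s : Fin q.N) :
    (Finset.univ.filter (fun j => j ≠ s ∧ a j = a s)).card = q.N / q.K - 1 := by
  rw [← ha (a s), ← Finset.card_erase_of_mem (a := s) (by simp)]
  congr 1
  ext j
  simp

theorem measurableSet_NI_eq_zero (q : Params) :
    MeasurableSet {p : (Fin q.N → ℝ) × (Fin q.N → Fin q.K) | interferers q p.1 p.2 = ∅} := by
  have : {p : (Fin q.N → ℝ) × (Fin q.N → Fin q.K) | interferers q p.1 p.2 = ∅} =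
      ⋂ i, {p | i ∈ interferers q p.1 p.2}ᶜ := by
    ext p
    simp [Finset.eq_empty_iff_forall_notMem]
  rw [this]
  exact MeasurableSet.iInter fun i => (measurableSet_mem_interferers q i).compl

/-- In a balanced assignment each satellite has N/K - 1 companions in its channel, so the
probability is the same for all of them and `measure_dists_assignment` applies. -/
theorem measure_R0_mem_NI_eq_zero [IsProbabilityMeasure P] (hq : q.Admissible) (hnet : IsNetwork q P u X c G) {B : Set ℝ}
    (hB : MeasurableSet B) (hBM : B ⊆ Set.Iic q.rMax) :
    P (R0 q u X ⁻¹' B ∩ {w | NI q u X c w = 0}) =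
      ∫⁻ r in B, ENNReal.ofReal (q.minWeight r) * ENNReal.ofReal (q.P0 r) ∂(distLaw q u) := by
  have hu := hnet.norm_user
  have hMm := hq.rMin_lt_rMax
  refine (congrArg P ?_).trans (measure_dists_assignment hnet
    (S := {p | ⨅ i, p.1 i ∈ B ∧ interferers q p.1 p.2 = ∅})
    ((measurable_fst (measurable_iInf_mem hB _)).inter (measurableSet_NI_eq_zero q))
    fun a ha => ?_)
  · ext w
    simp [NI, R0]
  · have h := pi_iInf_mem (distLaw q u) hq.N_pos (fun r hr => distLaw_singleton hq hu hr) hB hBM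
      (fun s => Finset.univ.filter (fun j => j ≠ s ∧ a j = a s)) (by simp)
      (fun s => card_filter_channel ha s) {d | interferers q d a = ∅} (by
        intro d s hs
        rw [Set.mem_ofPred_eq, interferers_eq_empty_iff hs]
        simp)
    refine h.trans (lintegral_congr_ae ?_)
    filter_upwards [ae_restrict_mem hB, ae_restrict_of_ae (rMin_le_distLaw hq hu)] with r hr hr'
    have hr0 := hq.rMin_pos.le.trans hr'
    have hlt := distCdf_lt_one hq hr0 (hBM hr)
    have hltM := distCdf_lt_one hq (hr0.trans (hBM hr)) le_rfl
    have hw : 0 ≤ q.minWeight r := mul_nonneg (by positivity) (pow_nonneg (by linarith) _)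
    rw [distLaw_Ioi hq hu hr' (hBM hr), distLaw_Ioi hq hu hMm.le le_rfl,
      ← ENNReal.ofReal_pow (by linarith), ← ENNReal.ofReal_pow (by linarith),
      ← ENNReal.ofReal_mul (pow_nonneg (by linarith) _), ← P0_mul_pow hq hr0 (hBM hr),
      ← ENNReal.ofReal_natCast, ← ENNReal.ofReal_mul (by positivity), ← ENNReal.ofReal_mul hw,
      Params.minWeight]
    congr 1
    ring

/-- Above the horizon the law of the serving distance has a density with respect to the law of a
single distance. -/
theorem map_R0_restrict (hq : q.Admissible) (hnet : IsNetwork q P u X c G) :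
    (P.map (R0 q u X)).restrict (Set.Iic q.rMax) =
      ((distLaw q u).restrict (Set.Iic q.rMax)).withDensity
        (fun r => ENNReal.ofReal (q.minWeight r)) := by
  ext B hB
  rw [Measure.restrict_apply hB, Measure.map_apply (measurable_R0 hnet.measurable_X)
    (hB.inter measurableSet_Iic), measure_R0_mem hq hnet (hB.inter measurableSet_Iic)
    Set.inter_subset_right, withDensity_apply _ hB, Measure.restrict_restrict hB]

theorem measurable_minWeight (q : Params) : Measurable q.minWeight := by
  unfold Params.minWeight Params.distCdf
  fun_prop

/-- The conditional probability of no interference, as a density. -/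
theorem map_R0_restrict_NI_eq_zero [IsProbabilityMeasure P] (hq : q.Admissible) (hnet : IsNetwork q P u X c G) :
    (P.restrict {w | NI q u X c w = 0}).map (R0 q u X) =
      (P.map (R0 q u X)).withDensity (fun r => ENNReal.ofReal (q.P0 r)) := by
  have hR := measurable_R0 (u := u) hnet.measurable_X
  have hN : MeasurableSet {w | NI q u X c w = 0} :=
    measurable_NI hnet.measurable_X hnet.measurable_c (measurableSet_singleton 0)
  have hlow : ∀ B, MeasurableSet B → B ⊆ Set.Iic q.rMax →
      P (R0 q u X ⁻¹' B ∩ {w | NI q u X c w = 0}) =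
        ∫⁻ r in B, ENNReal.ofReal (q.P0 r) ∂(P.map (R0 q u X)) := by
    intro B hB hBM
    rw [measure_R0_mem_NI_eq_zero hq hnet hB hBM]
    have h1 : (P.map (R0 q u X)).restrict B =
        ((P.map (R0 q u X)).restrict (Set.Iic q.rMax)).restrict B := by
      rw [Measure.restrict_restrict hB, Set.inter_eq_left.2 hBM]
    rw [h1, map_R0_restrict hq hnet, restrict_withDensity hB, Measure.restrict_restrict hB,
      Set.inter_eq_left.2 hBM, lintegral_withDensity_eq_lintegral_mul _
        (measurable_minWeight q).ennreal_ofReal (measurable_P0 q).ennreal_ofReal]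
    rfl
  -- When even the nearest satellite is below the horizon there are no interferers, in agreement
  -- with P_0 = 1.
  have hhigh : ∀ B, MeasurableSet B → B ⊆ Set.Ioi q.rMax →
      P (R0 q u X ⁻¹' B ∩ {w | NI q u X c w = 0}) =
        ∫⁻ r in B, ENNReal.ofReal (q.P0 r) ∂(P.map (R0 q u X)) := by
    intro B hB hBM
    rw [setLIntegral_congr_fun (g := fun _ => 1) hB, setLIntegral_one, Measure.map_apply hR hB]
    · congr 1
      rw [Set.inter_eq_left]
      intro w hw
      exact NI_eq_zero_of_rMax_lt (hBM hw)
    · intro r hr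
      have : ¬ r ≤ q.rMax := not_le.2 (hBM hr)
      simp [Params.P0, this]
  ext B hB
  rw [Measure.map_apply hR hB, Measure.restrict_apply (hR hB), withDensity_apply _ hB]
  have hsplit : B = (B ∩ Set.Iic q.rMax) ∪ (B ∩ Set.Ioi q.rMax) := by
    rw [← Set.inter_union_distrib_left, Set.Iic_union_Ioi, Set.inter_univ]
  have hdisj : Disjoint (B ∩ Set.Iic q.rMax) (B ∩ Set.Ioi q.rMax) :=
    Set.disjoint_left.2 fun r h h' => not_lt.2 (Set.mem_Iic.1 h.2) (Set.mem_Ioi.1 h'.2)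
  have hm1 := hB.inter (measurableSet_Iic (a := q.rMax))
  have hm2 := hB.inter (measurableSet_Ioi (a := q.rMax))
  rw [hsplit, lintegral_union hm2 hdisj, Set.preimage_union, Set.union_inter_distrib_right,
    measure_union _ ((hR hm2).inter hN), hlow _ hm1 Set.inter_subset_right,
    hhigh _ hm2 Set.inter_subset_right]
  exact (hdisj.preimage _).mono Set.inter_subset_left Set.inter_subset_left

end ServingDistance

/-! ### From the inverted Fourier integral to the mean logarithm. -/

section Threshold

variable {p A n x t : ℝ}

/-- `threshold p A n t` is the interference power at which the spectral efficiency is `t` nats. -/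
noncomputable def threshold (p A n t : ℝ) : ℝ := p / (A * (Real.exp t - 1)) - n

theorem exp_sub_one_pos (ht : 0 < t) : 0 < Real.exp t - 1 := by
  have := Real.add_one_lt_exp ht.ne'
  linarith

/-- Solves t < ln(1 + p / (A(x + n))) for x. Both strict versions are recorded because `Real.sign`
vanishes at equality, which happens for at most one t. -/
theorem threshold_sub_pos_iff (hp : 0 < p) (hA : 0 < A) (hn : 0 < n) (hx : 0 ≤ x) (ht : 0 < t) :
    0 < threshold p A n t - x ↔ t < Real.log (1 + p / A / (x + n)) := by
  have he := exp_sub_one_pos ht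
  have hxn : 0 < x + n := by linarith
  rw [Real.lt_log_iff_exp_lt (by positivity), ← sub_lt_iff_lt_add', threshold,
    lt_div_iff₀ hxn, lt_div_iff₀ hA, sub_sub, sub_pos, lt_div_iff₀ (by positivity), add_comm n x]
  constructor <;> intro h <;> linarith

theorem threshold_sub_neg_iff (hp : 0 < p) (hA : 0 < A) (hn : 0 < n) (hx : 0 ≤ x) (ht : 0 < t) :
    threshold p A n t - x < 0 ↔ Real.log (1 + p / A / (x + n)) < t := by
  have he := exp_sub_one_pos ht
  have hxn : 0 < x + n := by linarith
  rw [Real.log_lt_iff_lt_exp (by positivity), ← lt_sub_iff_add_lt', threshold,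
    div_lt_iff₀ hxn, div_lt_iff₀ hA, sub_sub, sub_neg, div_lt_iff₀ (by positivity), add_comm n x]
  constructor <;> intro h <;> linarith

/-- The value of the Fourier integral: twice `π` times the probability of an interference power
below the threshold, up to the atom at the threshold. -/
noncomputable def signTail (κ : Measure ℝ) (b : ℝ) : ℝ :=
  ∫ x, Real.pi * (Real.sign (b - x) + Real.sign x) ∂κ

theorem abs_sign_add_sign_le (b x : ℝ) : |Real.pi * (Real.sign (b - x) + Real.sign x)| ≤
    2 * Real.pi := by
  have h : ∀ y : ℝ, |Real.sign y| ≤ 1 := by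
    intro y
    rcases Real.sign_apply_eq y with h | h | h <;> rw [h] <;> norm_num
  rw [abs_mul, abs_of_pos Real.pi_pos]
  nlinarith [abs_add_le (Real.sign (b - x)) (Real.sign x), h (b - x), h x, Real.pi_pos]

theorem measurable_sign : Measurable Real.sign := by
  unfold Real.sign
  exact Measurable.ite measurableSet_Iio measurable_const
    (Measurable.ite measurableSet_Ioi measurable_const measurable_const)

/-- Beyond the interference-free rate the threshold is negative and the two signs cancel. Hence the
t-integrals effectively run over a bounded interval. -/
theorem sign_threshold_eq_zero (hp : 0 < p) (hA : 0 < A) (hn : 0 < n) (hx : 0 < x) (ht : 0 < t)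
    (hlt : Real.log (1 + p / A / n) < t) :
    Real.pi * (Real.sign (threshold p A n t - x) + Real.sign x) = 0 := by
  have h := (threshold_sub_neg_iff hp hA hn le_rfl ht).2 (by simpa using hlt)
  rw [Real.sign_of_neg (by linarith), Real.sign_of_pos hx]
  simp

theorem norm_sign_threshold_le (hp : 0 < p) (hA : 0 < A) (hn : 0 < n) (hx : 0 < x) (ht : 0 < t) :
    ‖Real.pi * (Real.sign (threshold p A n t - x) + Real.sign x)‖ ≤
      (Set.Iic (Real.log (1 + p / A / n))).indicator (fun _ => 2 * Real.pi) t := by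
  by_cases h : t ≤ Real.log (1 + p / A / n)
  · rw [Set.indicator_of_mem (by exact h)]
    exact abs_sign_add_sign_le _ _
  · rw [Set.indicator_of_notMem (by exact h),
      sign_threshold_eq_zero hp hA hn hx ht (not_le.1 h), norm_zero]

/-- Apart from one value of t, the integrand is 2π before the rate T and 0 after it: a layer-cake
formula for T. -/
theorem integral_sign_threshold (hp : 0 < p) (hA : 0 < A) (hn : 0 < n) (hx : 0 < x) :
    ∫ t in Set.Ioi (0 : ℝ), Real.pi * (Real.sign (threshold p A n t - x) + Real.sign x) =
      2 * Real.pi * Real.log (1 + p / A / (x + n)) := by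
  set T := Real.log (1 + p / A / (x + n)) with hT
  have hT0 : 0 ≤ T := Real.log_nonneg (by
    have : 0 ≤ p / A / (x + n) := by positivity
    linarith)
  have h : ∀ᵐ t ∂(volume.restrict (Set.Ioi (0 : ℝ))),
      Real.pi * (Real.sign (threshold p A n t - x) + Real.sign x) =
        (Set.Iio T).indicator (fun _ => 2 * Real.pi) t := by
    filter_upwards [ae_restrict_mem measurableSet_Ioi,
      ae_restrict_of_ae (Measure.ae_ne volume T)] with t ht hne
    rcases hne.lt_or_gt with hlt | hlt
    · rw [Set.indicator_of_mem (by exact hlt), Real.sign_of_pos hx,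
        Real.sign_of_pos ((threshold_sub_pos_iff hp hA hn hx.le ht).2 hlt)]
      ring
    · rw [Set.indicator_of_notMem (by simpa using hlt.le), Real.sign_of_pos hx,
        Real.sign_of_neg ((threshold_sub_neg_iff hp hA hn hx.le ht).2 hlt)]
      ring
  rw [integral_congr_ae h, integral_indicator measurableSet_Iio,
    Measure.restrict_restrict measurableSet_Iio, Set.Iio_inter_Ioi, setIntegral_const]
  simp [hT0, mul_comm]

theorem measurable_threshold (p A n : ℝ) : Measurable (threshold p A n) := by
  unfold threshold
  fun_prop

theorem integrable_indicator_Iic_const (T C : ℝ) :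
    Integrable ((Set.Iic T).indicator fun _ => C) (volume.restrict (Set.Ioi (0 : ℝ))) := by
  rw [integrable_indicator_iff measurableSet_Iic, IntegrableOn,
    Measure.restrict_restrict measurableSet_Iic, Set.inter_comm, Set.Ioi_inter_Iic]
  exact integrable_const _

/-- Exchange the integrals in t and x; `norm_sign_threshold_le` provides a bound that is integrable
on the product. -/
theorem integral_signTail (κ : Measure ℝ) [IsProbabilityMeasure κ] (hκ : ∀ᵐ x ∂κ, 0 < x)
    (hp : 0 < p) (hA : 0 < A) (hn : 0 < n) :
    ∫ t in Set.Ioi (0 : ℝ), signTail κ (threshold p A n t) =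
      2 * Real.pi * ∫ x, Real.log (1 + p / A / (x + n)) ∂κ := by
  unfold signTail
  rw [integral_integral_swap, ← integral_const_mul]
  · refine integral_congr_ae ?_
    filter_upwards [hκ] with x hx using integral_sign_threshold hp hA hn hx
  · have hmeas : Measurable fun z : ℝ × ℝ =>
        Real.pi * (Real.sign (threshold p A n z.1 - z.2) + Real.sign z.2) :=
      ((measurable_sign.comp (((measurable_threshold p A n).comp measurable_fst).sub
        measurable_snd)).add (measurable_sign.comp measurable_snd)).const_mul _
    refine Integrable.mono' ((integrable_indicator_Iic_const (Real.log (1 + p / A / n))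
      (2 * Real.pi)).comp_fst κ) hmeas.aestronglyMeasurable ?_
    have h1 := (Measure.quasiMeasurePreserving_fst (μ := volume.restrict (Set.Ioi (0 : ℝ)))
      (ν := κ)).ae (ae_restrict_mem measurableSet_Ioi)
    have h2 := (Measure.quasiMeasurePreserving_snd (μ := volume.restrict (Set.Ioi (0 : ℝ)))
      (ν := κ)).ae hκ
    filter_upwards [h1, h2] with z hz1 hz2
    exact norm_sign_threshold_le hp hA hn hz2 hz1

theorem abs_signTail_threshold_le (κ : Measure ℝ) [IsProbabilityMeasure κ] (hκ : ∀ᵐ x ∂κ, 0 < x)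
    (hp : 0 < p) (hA : 0 < A) (hn : 0 < n) (ht : 0 < t) :
    |signTail κ (threshold p A n t)| ≤
      (Set.Iic (Real.log (1 + p / A / n))).indicator (fun _ => 2 * Real.pi) t := by
  have := norm_integral_le_of_norm_le (μ := κ) (integrable_const
    ((Set.Iic (Real.log (1 + p / A / n))).indicator (fun _ => 2 * Real.pi) t))
    (hκ.mono fun x hx => norm_sign_threshold_le hp hA hn hx ht)
  rw [integral_const, probReal_univ, one_smul] at this
  exact this

end Threshold

/-! ### Conditional probabilities expressed as densities. -/

section Conditioning

variable {Ω : Type*} [MeasurableSpace Ω] {P : Measure Ω} {Y : Ω → ℝ}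
  {E : Set Ω} {ρ : ℝ → ℝ}

/-- Here ρ plays the role of the probability of E given Y. Stating this as a density turns integrals
over the event into integrals against the law of Y. -/
theorem setIntegral_preimage_inter_of_density (hY : Measurable Y)
    (hρ : Measurable ρ) (hρ0 : ∀ᵐ r ∂(P.map Y), 0 ≤ ρ r)
    (h : (P.restrict E).map Y = (P.map Y).withDensity fun r => ENNReal.ofReal (ρ r))
    {φ : ℝ → ℝ} (hφ : Measurable φ) {s : Set ℝ} (hs : MeasurableSet s) :
    ∫ w in Y ⁻¹' s ∩ E, φ (Y w) ∂P = ∫ r in s, ρ r * φ r ∂(P.map Y) := by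
  rw [← Measure.restrict_restrict (hY hs), ← setIntegral_map hs
    hφ.aestronglyMeasurable hY.aemeasurable, h, restrict_withDensity hs,
    integral_withDensity_eq_integral_toReal_smul hρ.ennreal_ofReal
      (Eventually.of_forall fun _ => ENNReal.ofReal_lt_top)]
  refine integral_congr_ae ?_
  filter_upwards [ae_restrict_of_ae hρ0] with r hr
  rw [ENNReal.toReal_ofReal hr, smul_eq_mul]

theorem integrable_mul_of_density (hY : Measurable Y)
    (hρ : Measurable ρ) (hρ0 : ∀ᵐ r ∂(P.map Y), 0 ≤ ρ r)
    (h : (P.restrict E).map Y = (P.map Y).withDensity fun r => ENNReal.ofReal (ρ r))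
    {φ : ℝ → ℝ} (hφ : Measurable φ) (hint : IntegrableOn (fun w => φ (Y w)) E P) :
    Integrable (fun r => ρ r * φ r) (P.map Y) := by
  have h1 : Integrable φ ((P.restrict E).map Y) :=
    (integrable_map_measure hφ.aestronglyMeasurable hY.aemeasurable).2 hint
  rw [h, integrable_withDensity_iff_integrable_smul' hρ.ennreal_ofReal
    (Eventually.of_forall fun _ => ENNReal.ofReal_lt_top)] at h1
  refine h1.congr ?_
  filter_upwards [hρ0] with r hr
  rw [ENNReal.toReal_ofReal hr, smul_eq_mul]

/-- Both functions have the same integral over every measurable set: the probability that Y is in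
the set and Z in T. -/
theorem condDistrib_apply_ae_eq [IsFiniteMeasure P] {S : Type*}
    [MeasurableSpace S] [StandardBorelSpace S] [Nonempty S]
    {Z : Ω → S} (hY : Measurable Y) (hZ : Measurable Z) {T : Set S} (hT : MeasurableSet T)
    (hρ : Measurable ρ)
    (h : (P.restrict (Z ⁻¹' T)).map Y = (P.map Y).withDensity fun r => ENNReal.ofReal (ρ r)) :
    (fun r => condDistrib Z Y P r T) =ᵐ[P.map Y] fun r => ENNReal.ofReal (ρ r) := by
  refine ae_eq_of_forall_setLIntegral_eq_of_sigmaFinite (Kernel.measurable_coe _ hT)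
    hρ.ennreal_ofReal fun s hs _ => ?_
  rw [← withDensity_apply (fun r => ENNReal.ofReal (ρ r)) hs, ← h, Measure.map_apply hY hs, Measure.restrict_apply (hY hs),
    ← setLIntegral_preimage_condDistrib hY hZ.aemeasurable hT hs, Measure.restrict_map hY hs,
    lintegral_map (Kernel.measurable_coe _ hT) hY]

end Conditioning

/-! ### Bounds on the rate, and its conditional means given R_0 with or without interference. -/

/-- Spectral efficiency at serving distance `r` and interference power `x`. -/
noncomputable def spectral (q : Params) (g : ServingGain) (r x : ℝ) : ℝ :=
  Real.logb 2 (1 + q.pS * g.gain q r * r ^ (-q.alpha) / (x + q.noise))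

theorem spectral_zero (q : Params) (g : ServingGain) (r : ℝ) :
    spectral q g r 0 = Real.logb 2 (1 + snr q g r) := by
  rw [spectral, zero_add, snr]

theorem measurable_logb (b : ℝ) : Measurable (Real.logb b) :=
  Real.measurable_log.div_const _

theorem measurable_spectral (q : Params) (g : ServingGain) :
    Measurable fun p : ℝ × ℝ => spectral q g p.1 p.2 := by
  have hg : Measurable fun p : ℝ × ℝ => g.gain q p.1 := (measurable_gain q g).comp measurable_fst
  unfold spectral
  exact (measurable_logb 2).comp (measurable_const.add
    (((hg.const_mul q.pS).mul (measurable_fst.pow_const _)).div (measurable_snd.add_const _)))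

theorem gain_nonneg (q : Params) (g : ServingGain) (r : ℝ) : 0 ≤ g.gain q r := by
  cases g
  · exact zero_le_one
  · simp only [ServingGain.gain]; split_ifs <;> norm_num

theorem gain_le_one (q : Params) (g : ServingGain) (r : ℝ) : g.gain q r ≤ 1 := by
  cases g
  · exact le_rfl
  · simp only [ServingGain.gain]; split_ifs <;> norm_num

theorem gain_of_le {q : Params} (g : ServingGain) {r : ℝ} (hr : r ≤ q.rMax) : g.gain q r = 1 := by
  cases g <;> simp [ServingGain.gain, hr]

/-- The largest spectral efficiency, that of a satellite in the zenith without interference. -/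
noncomputable def Params.maxSpectral (q : Params) : ℝ :=
  Real.logb 2 (1 + q.pS * q.rMin ^ (-q.alpha) / q.noise)

theorem spectral_nonneg {q : Params} (hq : q.Admissible) (g : ServingGain) {r x : ℝ} (hr : 0 ≤ r)
    (hx : 0 ≤ x) : 0 ≤ spectral q g r x := by
  have h1 := hq.pS_pos
  have h2 := hq.noise_pos
  have h3 := gain_nonneg q g r
  refine Real.logb_nonneg one_lt_two ?_
  have : 0 ≤ q.pS * g.gain q r * r ^ (-q.alpha) / (x + q.noise) := by positivity
  linarith

theorem spectral_le {q : Params} (hq : q.Admissible) (g : ServingGain) {r x : ℝ}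
    (hr : q.rMin ≤ r) (hx : 0 ≤ x) : spectral q g r x ≤ q.maxSpectral := by
  have h1 := hq.pS_pos
  have h2 := hq.noise_pos
  have h3 := gain_nonneg q g r
  have h5 := hq.rMin_pos
  have h6 : 0 < r := h5.trans_le hr
  refine Real.logb_le_logb_of_le one_lt_two (by positivity) ?_
  have h7 : q.pS * g.gain q r * r ^ (-q.alpha) ≤ q.pS * q.rMin ^ (-q.alpha) :=
    mul_le_mul (mul_le_of_le_one_right h1.le (gain_le_one q g r))
      (Real.rpow_le_rpow_of_nonpos h5 hr (by linarith [hq.alpha_pos])) (by positivity) h1.le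
  linarith [div_le_div₀ (by positivity) h7 h2 (by linarith : q.noise ≤ x + q.noise)]

/-- Serving distance together with the indicator of interference. -/
noncomputable def conditioner (q : Params) {Ω : Type*} (u : E3) (X : Fin q.N → Ω → E3)
    (c : Ω → Fin q.N → Fin q.K) (w : Ω) : ℝ × Bool :=
  (R0 q u X w, decide (0 < NI q u X c w))

theorem preimage_conditioner {q : Params} {Ω : Type*} {u : E3} {X : Fin q.N → Ω → E3}
    {c : Ω → Fin q.N → Fin q.K} (s : Set ℝ) :
    conditioner q u X c ⁻¹' (s ×ˢ {true}) = R0 q u X ⁻¹' s ∩ {w | 0 < NI q u X c w} := by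
  ext w
  simp [conditioner]

section Network

variable {q : Params} {Ω : Type*} [MeasurableSpace Ω] {P : Measure Ω}
  {u : E3} {X : Fin q.N → Ω → E3} {c : Ω → Fin q.N → Fin q.K} {G : Fin q.N → Ω → ℝ}

theorem rMin_le_dists (hq : q.Admissible) (hnet : IsNetwork q P u X c G) :
    ∀ᵐ w ∂P, ∀ i, q.rMin ≤ dists q u X w i := by
  rw [ae_all_iff]
  intro i
  have h := rMin_le_distLaw hq hnet.norm_user
  rw [distLaw, ← hnet.law_X i, Measure.map_map (by fun_prop) (hnet.measurable_X i)] at h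
  exact ae_of_ae_map (((by fun_prop : Measurable fun x : E3 => dist x u).comp
    (hnet.measurable_X i)).aemeasurable) h

theorem rMin_le_R0 (hq : q.Admissible) (hnet : IsNetwork q P u X c G) :
    ∀ᵐ w ∂P, q.rMin ≤ R0 q u X w := by
  have : Nonempty (Fin q.N) := ⟨⟨0, hq.N_pos⟩⟩
  filter_upwards [rMin_le_dists hq hnet] with w hw using le_ciInf hw

theorem rMin_le_map_R0 (hq : q.Admissible) (hnet : IsNetwork q P u X c G) :
    ∀ᵐ r ∂(P.map (R0 q u X)), q.rMin ≤ r :=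
  (ae_map_iff (measurable_R0 hnet.measurable_X).aemeasurable measurableSet_Ici).2
    (rMin_le_R0 hq hnet)

theorem interference_nonneg (hq : q.Admissible) (hnet : IsNetwork q P u X c G) :
    ∀ᵐ w ∂P, 0 ≤ interference q u X c G w := by
  filter_upwards [ae_all_iff.2 hnet.G_pos] with w hG
  have := hq.pI_pos
  exact Finset.sum_nonneg fun i _ => mul_nonneg (mul_nonneg this.le (hG i).le)
    (Real.rpow_nonneg dist_nonneg _)

/-- Positivity is what makes `Real.sign x` equal to 1 in the inversion formula. It rests on the
positive gains and on distances bounded away from 0. -/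
theorem interference_pos (hq : q.Admissible) (hnet : IsNetwork q P u X c G) :
    ∀ᵐ w ∂P, 0 < NI q u X c w → 0 < interference q u X c G w := by
  filter_upwards [ae_all_iff.2 hnet.G_pos, rMin_le_dists hq hnet] with w hG hd hN
  refine Finset.sum_pos (fun i _ => mul_pos (mul_pos hq.pI_pos (hG i)) ?_) (Finset.card_pos.1 hN)
  exact Real.rpow_pos_of_pos (hq.rMin_pos.trans_le (hd i)) _

theorem measurable_rate (hnet : IsNetwork q P u X c G) (g : ServingGain) :
    Measurable fun w => Real.logb 2 (1 + sinr q u X c G g w) :=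
  (measurable_logb 2).comp (measurable_const.add
    (measurable_sinr hnet.measurable_X hnet.measurable_c hnet.measurable_G g))

theorem measurableSet_NI_pos (hnet : IsNetwork q P u X c G) :
    MeasurableSet {w | 0 < NI q u X c w} :=
  measurableSet_lt measurable_const (measurable_NI hnet.measurable_X hnet.measurable_c)

theorem measurable_conditioner (hnet : IsNetwork q P u X c G) :
    Measurable (conditioner q u X c) :=
  (measurable_R0 hnet.measurable_X).prodMk (measurable_to_bool (by
    convert! measurableSet_NI_pos hnet
    ext w; simp))

variable [IsProbabilityMeasure P]

/-- The rate is bounded, because no satellite comes closer than `rMin` and the noise power is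
positive. -/
theorem integrable_rate (hq : q.Admissible) (hnet : IsNetwork q P u X c G) (g : ServingGain) :
    Integrable (fun w => Real.logb 2 (1 + sinr q u X c G g w)) P := by
  refine Integrable.of_bound (measurable_rate hnet g).aestronglyMeasurable q.maxSpectral ?_
  filter_upwards [rMin_le_R0 hq hnet, interference_nonneg hq hnet] with w hw hI
  change ‖spectral q g (R0 q u X w) (interference q u X c G w)‖ ≤ _
  rw [Real.norm_eq_abs, abs_of_nonneg (spectral_nonneg hq g (hq.rMin_pos.le.trans hw) hI)]
  exact spectral_le hq g hw hI

theorem integrable_snr_rate (hq : q.Admissible) (hnet : IsNetwork q P u X c G) (g : ServingGain) :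
    Integrable (fun w => Real.logb 2 (1 + snr q g (R0 q u X w))) P := by
  simp_rw [← spectral_zero]
  refine Integrable.of_bound ((measurable_spectral q g).comp
    ((measurable_R0 hnet.measurable_X).prodMk measurable_const)).aestronglyMeasurable
    q.maxSpectral ?_
  filter_upwards [rMin_le_R0 hq hnet] with w hw
  rw [Real.norm_eq_abs,
    abs_of_nonneg (spectral_nonneg hq g (hq.rMin_pos.le.trans hw) le_rfl)]
  exact spectral_le hq g hw le_rfl

/-- The conditional probability of interference, as a density. -/
theorem map_R0_restrict_NI_pos (hq : q.Admissible) (hnet : IsNetwork q P u X c G) :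
    (P.restrict {w | 0 < NI q u X c w}).map (R0 q u X) =
      (P.map (R0 q u X)).withDensity (fun r => ENNReal.ofReal (1 - q.P0 r)) := by
  have hR := measurable_R0 (u := u) hnet.measurable_X
  have h0 := map_R0_restrict_NI_eq_zero hq hnet
  have hcompl : {w | 0 < NI q u X c w} = {w | NI q u X c w = 0}ᶜ := by
    ext w; simp [Nat.pos_iff_ne_zero]
  have hN : MeasurableSet {w | NI q u X c w = 0} :=
    measurable_NI hnet.measurable_X hnet.measurable_c (measurableSet_singleton 0)
  ext B hB
  have hsum : (P.restrict {w | NI q u X c w = 0}).map (R0 q u X) B +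
      (P.restrict {w | 0 < NI q u X c w}).map (R0 q u X) B = P.map (R0 q u X) B := by
    rw [hcompl, Measure.map_apply hR hB, Measure.map_apply hR hB, Measure.map_apply hR hB,
      ← Measure.add_apply, Measure.restrict_add_restrict_compl hN]
  have hsum' : (P.map (R0 q u X)).withDensity (fun r => ENNReal.ofReal (q.P0 r)) B +
      (P.map (R0 q u X)).withDensity (fun r => ENNReal.ofReal (1 - q.P0 r)) B =
        P.map (R0 q u X) B := by
    rw [withDensity_apply _ hB, withDensity_apply _ hB,
      ← lintegral_add_left (measurable_P0 q).ennreal_ofReal]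
    trans ∫⁻ _ in B, 1 ∂(P.map (R0 q u X))
    · refine lintegral_congr_ae ?_
      filter_upwards [ae_restrict_of_ae (rMin_le_map_R0 hq hnet)] with r hr
      have hr0 := hq.rMin_pos.le.trans hr
      rw [← ENNReal.ofReal_add (P0_nonneg hq hr0) (by linarith [P0_le_one hq hr0])]
      simp
    · exact setLIntegral_one B
  rw [h0] at hsum
  have hfin : (P.map (R0 q u X)).withDensity (fun r => ENNReal.ofReal (q.P0 r)) B ≠ ⊤ := by
    refine ne_top_of_le_ne_top (measure_ne_top (P.map (R0 q u X)) B) ?_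
    rw [← hsum']
    exact le_self_add
  exact (ENNReal.add_right_inj hfin).1 (hsum.trans hsum'.symm)

theorem measurable_integral_lawGivenInterf (Z : Ω → ℝ) {f : ℝ × ℝ → ℝ} (hf : Measurable f) :
    Measurable fun r => ∫ x, f (r, x) ∂(lawGivenInterf q u X c P Z r) := by
  have h := (StronglyMeasurable.integral_kernel_prod_right'
    (κ := condDistrib Z (conditioner q u X c) P)
    (f := fun p : (ℝ × Bool) × ℝ => f (p.1.1, p.2))
    (by exact (hf.comp (by fun_prop)).stronglyMeasurable)).measurable
  exact h.comp (measurable_id.prodMk measurable_const)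

theorem measurable_rateGivenInterf (g : ServingGain) :
    Measurable (rateGivenInterf q u X c G P g) :=
  measurable_integral_lawGivenInterf _ measurable_snd

instance isProbabilityMeasure_lawGivenInterf (Z : Ω → ℝ) (r : ℝ) :
    IsProbabilityMeasure (lawGivenInterf q u X c P Z r) := by
  unfold lawGivenInterf
  infer_instance

theorem condExp_rate_ae_eq (hq : q.Admissible) (hnet : IsNetwork q P u X c G) (g : ServingGain) :
    ∀ᵐ w ∂P, 0 < NI q u X c w →
      (P[fun w => Real.logb 2 (1 + sinr q u X c G g w) |
        MeasurableSpace.comap (conditioner q u X c) inferInstance]) w =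
        rateGivenInterf q u X c G P g (R0 q u X w) := by
  filter_upwards [condExp_ae_eq_integral_condDistrib' (measurable_conditioner hnet)
    (integrable_rate hq hnet g)] with w hw hN
  rw [hw, rateGivenInterf, lawGivenInterf]
  simp only [conditioner, hN, decide_true]
  rfl

/-- The left side uses the conditional law of the rate, the right side that of the interference.
Both are versions of one conditional expectation, since the rate is a function of I and of R_0,
which is part of the conditioning variable. -/
theorem rateGivenInterf_ae_eq (hq : q.Admissible) (hnet : IsNetwork q P u X c G)
    (g : ServingGain) :
    ∀ᵐ w ∂P, 0 < NI q u X c w → rateGivenInterf q u X c G P g (R0 q u X w) =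
      ∫ x, spectral q g (R0 q u X w) x
        ∂(lawGivenInterf q u X c P (interference q u X c G) (R0 q u X w)) := by
  have h := condExp_prod_ae_eq_integral_condDistrib (μ := P) (measurable_conditioner hnet)
    (measurable_interference hnet.measurable_X hnet.measurable_c hnet.measurable_G).aemeasurable
    (f := fun p : (ℝ × Bool) × ℝ => spectral q g p.1.1 p.2)
    (((measurable_spectral q g).comp (by fun_prop :
      Measurable fun p : (ℝ × Bool) × ℝ => (p.1.1, p.2))).stronglyMeasurable)
    (integrable_rate hq hnet g)
  filter_upwards [condExp_rate_ae_eq hq hnet g, h] with w hw hw' hN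
  rw [← hw hN]
  refine hw'.trans ?_
  rw [lawGivenInterf]
  simp only [conditioner, hN, decide_true]
  rfl

/-- The event {I ≤ 0, N_I > 0} is null, and disintegrating it along the conditioner gives a
vanishing integral of a nonnegative function. -/
theorem lawGivenInterf_Iic_zero (hq : q.Admissible) (hnet : IsNetwork q P u X c G) :
    ∀ᵐ w ∂P, 0 < NI q u X c w →
      lawGivenInterf q u X c P (interference q u X c G) (R0 q u X w) (Set.Iic 0) = 0 := by
  have hc := measurable_conditioner hnet
  have hI := measurable_interference (u := u) hnet.measurable_X hnet.measurable_c
    hnet.measurable_G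
  have h := setLIntegral_preimage_condDistrib (μ := P) hc hI.aemeasurable
    (measurableSet_Iic (a := (0 : ℝ))) (t := Set.univ ×ˢ {true})
    (MeasurableSet.univ.prod (measurableSet_singleton true))
  have hk : Measurable fun w => condDistrib (interference q u X c G) (conditioner q u X c) P
      (conditioner q u X c w) (Set.Iic 0) :=
    (Kernel.measurable_coe _ measurableSet_Iic).comp hc
  have hz : P (conditioner q u X c ⁻¹' (Set.univ ×ˢ {true}) ∩
      interference q u X c G ⁻¹' Set.Iic 0) = 0 := by
    rw [preimage_conditioner, Set.preimage_univ, Set.univ_inter]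
    refine measure_mono_null ?_ (interference_pos hq hnet)
    rintro w ⟨h1, h2⟩ h3
    exact absurd (h3 h1) (not_lt.2 h2)
  rw [hz, preimage_conditioner, Set.preimage_univ, Set.univ_inter, lintegral_eq_zero_iff hk, EventuallyEq,
    ae_restrict_iff' (measurableSet_NI_pos hnet)] at h
  filter_upwards [h] with w hw hN
  have := hw hN
  rw [lawGivenInterf]
  simpa [conditioner, hN] using! this

/-- Description of the conditional rate by the conditional law of the interference. -/
theorem rateGivenInterf_eq_of_NI_pos (hq : q.Admissible) (hnet : IsNetwork q P u X c G)
    (g : ServingGain) :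
    ∀ᵐ r ∂(P.restrict {w | 0 < NI q u X c w}).map (R0 q u X),
      rateGivenInterf q u X c G P g r =
        ∫ x, spectral q g r x ∂(lawGivenInterf q u X c P (interference q u X c G) r) ∧
      lawGivenInterf q u X c P (interference q u X c G) r (Set.Iic 0) = 0 := by
  rw [ae_map_iff (measurable_R0 hnet.measurable_X).aemeasurable, ae_restrict_iff'
    (measurableSet_NI_pos hnet)]
  · filter_upwards [rateGivenInterf_ae_eq hq hnet g, lawGivenInterf_Iic_zero hq hnet]
      with w h1 h2 hN using ⟨h1 hN, h2 hN⟩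
  · refine (measurableSet_eq_fun (measurable_rateGivenInterf g)
      (measurable_integral_lawGivenInterf _ (measurable_spectral q g))).inter ?_
    have : Measurable fun r =>
        lawGivenInterf q u X c P (interference q u X c G) r (Set.Iic 0) :=
      (Kernel.measurable_coe _ measurableSet_Iic).comp (measurable_id.prodMk measurable_const)
    exact this (measurableSet_singleton 0)

theorem integrableOn_rateGivenInterf_NI_pos (hq : q.Admissible) (hnet : IsNetwork q P u X c G)
    (g : ServingGain) :
    IntegrableOn (fun w => rateGivenInterf q u X c G P g (R0 q u X w))
      {w | 0 < NI q u X c w} P := by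
  refine (integrable_condExp (μ := P) (f := fun w => Real.logb 2 (1 + sinr q u X c G g w))
    (m := MeasurableSpace.comap (conditioner q u X c) inferInstance)).integrableOn.congr ?_
  rw [EventuallyEq, ae_restrict_iff' (measurableSet_NI_pos hnet)]
  exact condExp_rate_ae_eq hq hnet g

/-- The domain belongs to the σ-algebra of the conditioner, so the rate may be replaced by its
conditional expectation; on {N_I > 0} this is a function of R_0 alone, and the density 1 - P_0
applies. -/
theorem setIntegral_rate_NI_pos (hq : q.Admissible) (hnet : IsNetwork q P u X c G)
    (g : ServingGain) {s : Set ℝ} (hs : MeasurableSet s) :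
    ∫ w in R0 q u X ⁻¹' s ∩ {w | 0 < NI q u X c w}, Real.logb 2 (1 + sinr q u X c G g w) ∂P =
      ∫ r in s, (1 - q.P0 r) * rateGivenInterf q u X c G P g r ∂(P.map (R0 q u X)) := by
  have hR := measurable_R0 (u := u) hnet.measurable_X
  have hm : MeasurableSet (R0 q u X ⁻¹' s ∩ {w | 0 < NI q u X c w}) :=
    (hR hs).inter (measurableSet_NI_pos hnet)
  rw [← setIntegral_preimage_inter_of_density hR (ρ := fun r => 1 - q.P0 r)
    (measurable_const.sub (measurable_P0 q)) ?_ (map_R0_restrict_NI_pos hq hnet)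
    (measurable_rateGivenInterf g) hs]
  · rw [← setIntegral_condExp (measurable_conditioner hnet).comap_le (integrable_rate hq hnet g)
      ⟨s ×ˢ {true}, hs.prod (measurableSet_singleton true), preimage_conditioner s⟩]
    refine setIntegral_congr_ae hm ?_
    filter_upwards [condExp_rate_ae_eq hq hnet g] with w hw hmem using hw hmem.2
  · filter_upwards [rMin_le_map_R0 hq hnet] with r hr
    linarith [P0_le_one hq (hq.rMin_pos.le.trans hr)]

/-- Without interferers I is an empty sum, so the SINR is the SNR, a function of R_0. -/
theorem setIntegral_rate_NI_eq_zero (hq : q.Admissible) (hnet : IsNetwork q P u X c G)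
    (g : ServingGain) {s : Set ℝ} (hs : MeasurableSet s) :
    ∫ w in R0 q u X ⁻¹' s ∩ {w | NI q u X c w = 0}, Real.logb 2 (1 + sinr q u X c G g w) ∂P =
      ∫ r in s, q.P0 r * Real.logb 2 (1 + snr q g r) ∂(P.map (R0 q u X)) := by
  have hR := measurable_R0 (u := u) hnet.measurable_X
  have hN : MeasurableSet {w | NI q u X c w = 0} :=
    measurable_NI hnet.measurable_X hnet.measurable_c (measurableSet_singleton 0)
  simp_rw [← spectral_zero]
  rw [← setIntegral_preimage_inter_of_density hR (measurable_P0 q) ?_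
    (map_R0_restrict_NI_eq_zero hq hnet) (φ := fun r => spectral q g r 0)
    ((measurable_spectral q g).comp (measurable_id.prodMk measurable_const)) hs]
  · refine setIntegral_congr_fun ((hR hs).inter hN) fun w hw => ?_
    have hI : interference q u X c G w = 0 := by
      have h0 : NI q u X c w = 0 := hw.2
      rw [interference, Finset.card_eq_zero.1 h0, Finset.sum_empty]
    change spectral q g (R0 q u X w) (interference q u X c G w) = _
    rw [hI]
  · filter_upwards [rMin_le_map_R0 hq hnet] with r hr
      using P0_nonneg hq (hq.rMin_pos.le.trans hr)

theorem setIntegral_rate_split (hq : q.Admissible) (hnet : IsNetwork q P u X c G)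
    (g : ServingGain) {s : Set ℝ} (hs : MeasurableSet s) :
    ∫ w in R0 q u X ⁻¹' s, Real.logb 2 (1 + sinr q u X c G g w) ∂P =
      (∫ r in s, q.P0 r * Real.logb 2 (1 + snr q g r) ∂(P.map (R0 q u X))) +
      ∫ r in s, (1 - q.P0 r) * rateGivenInterf q u X c G P g r ∂(P.map (R0 q u X)) := by
  rw [← setIntegral_rate_NI_eq_zero hq hnet g hs, ← setIntegral_rate_NI_pos hq hnet g hs]
  have hcompl : {w | 0 < NI q u X c w} = {w | NI q u X c w = 0}ᶜ := by
    ext w; simp [Nat.pos_iff_ne_zero]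
  have hN : MeasurableSet {w | NI q u X c w = 0} :=
    measurable_NI hnet.measurable_X hnet.measurable_c (measurableSet_singleton 0)
  rw [hcompl, ← Set.sdiff_eq]
  exact (integral_inter_add_sdiff hN (integrable_rate hq hnet g).integrableOn).symm

theorem integrable_P0_mul_snr_rate (hq : q.Admissible) (hnet : IsNetwork q P u X c G)
    (g : ServingGain) :
    Integrable (fun r => q.P0 r * Real.logb 2 (1 + snr q g r)) (P.map (R0 q u X)) := by
  refine integrable_mul_of_density (measurable_R0 hnet.measurable_X) (measurable_P0 q) ?_
    (map_R0_restrict_NI_eq_zero hq hnet) ?_ (integrable_snr_rate hq hnet g).integrableOn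
  · filter_upwards [rMin_le_map_R0 hq hnet] with r hr
      using P0_nonneg hq (hq.rMin_pos.le.trans hr)
  · simp_rw [← spectral_zero]
    exact (measurable_spectral q g).comp (measurable_id.prodMk measurable_const)

theorem integrable_one_sub_P0_mul_rate (hq : q.Admissible) (hnet : IsNetwork q P u X c G)
    (g : ServingGain) :
    Integrable (fun r => (1 - q.P0 r) * rateGivenInterf q u X c G P g r) (P.map (R0 q u X)) := by
  refine integrable_mul_of_density (measurable_R0 hnet.measurable_X) (ρ := fun r => 1 - q.P0 r)
    (measurable_const.sub (measurable_P0 q)) ?_ (map_R0_restrict_NI_pos hq hnet)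
    (measurable_rateGivenInterf g) (integrableOn_rateGivenInterf_NI_pos hq hnet g)
  filter_upwards [rMin_le_map_R0 hq hnet] with r hr
  linarith [P0_le_one hq (hq.rMin_pos.le.trans hr)]

/-- Splitting of the conditional rate given the serving distance. -/
theorem integral_lawGivenR0_rate (hq : q.Admissible) (hnet : IsNetwork q P u X c G)
    (g : ServingGain) :
    ∀ᵐ r ∂(P.map (R0 q u X)),
      ∫ z, z ∂(lawGivenR0 q u X P (fun w => Real.logb 2 (1 + sinr q u X c G g w)) r) =
        q.P0 r * Real.logb 2 (1 + snr q g r) +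
          (1 - q.P0 r) * rateGivenInterf q u X c G P g r := by
  have hR := measurable_R0 (u := u) hnet.measurable_X
  set Z := fun w => Real.logb 2 (1 + sinr q u X c G g w) with hZ
  have hZi : Integrable Z P := integrable_rate hq hnet g
  have hmeas : Measurable fun r => ∫ z, z ∂(lawGivenR0 q u X P Z r) :=
    (StronglyMeasurable.integral_kernel (κ := condDistrib Z (R0 q u X) P)
      stronglyMeasurable_id).measurable
  have hce := condExp_ae_eq_integral_condDistrib' hR hZi
  have hint : Integrable (fun r => ∫ z, z ∂(lawGivenR0 q u X P Z r)) (P.map (R0 q u X)) :=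
    (integrable_map_measure hmeas.aestronglyMeasurable hR.aemeasurable).2
      (integrable_condExp.congr hce)
  have h1 := integrable_P0_mul_snr_rate hq hnet g
  have h2 := integrable_one_sub_P0_mul_rate hq hnet g
  refine hint.ae_eq_of_forall_setIntegral_eq _ _ (h1.add h2) fun s hs _ => ?_
  rw [integral_add h1.integrableOn h2.integrableOn, ← setIntegral_rate_split hq hnet g hs,
    setIntegral_map hs hmeas.aestronglyMeasurable hR.aemeasurable,
    ← setIntegral_condExp hR.comap_le hZi ⟨s, hs, rfl⟩]
  refine setIntegral_congr_ae (hR hs) ?_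
  filter_upwards [hce] with w hw _ using hw.symm

theorem lawGivenR0_NI_real_zero (hq : q.Admissible) (hnet : IsNetwork q P u X c G) :
    ∀ᵐ r ∂(P.map (R0 q u X)), (lawGivenR0 q u X P (NI q u X c) r).real {0} = q.P0 r := by
  filter_upwards [condDistrib_apply_ae_eq (measurable_R0 hnet.measurable_X)
    (measurable_NI hnet.measurable_X hnet.measurable_c) (measurableSet_singleton 0)
    (measurable_P0 q) (map_R0_restrict_NI_eq_zero hq hnet), rMin_le_map_R0 hq hnet] with r h hr
  rw [measureReal_def, lawGivenR0, h,
    ENNReal.toReal_ofReal (P0_nonneg hq (hq.rMin_pos.le.trans hr))]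

end Network

/-! ### The SNR term. -/

section SnrTerm

variable {q : Params}

/-- The largest serving distance at which the interference-free spectral efficiency is at least
`t` nats. -/
noncomputable def snrRange (q : Params) : ServingGain → ℝ → ℝ
  | .always, t => (q.pS / ((Real.exp t - 1) * q.noise)) ^ (1 / q.alpha)
  | .aboveHorizon, t => min ((q.pS / ((Real.exp t - 1) * q.noise)) ^ (1 / q.alpha)) q.rMax

/-- The factor 1 stands for the serving gain, so that the statement matches `snr` under either
convention once the gain is evaluated. -/
theorem le_log_one_add_iff_le_rpow (hq : q.Admissible) {r t : ℝ} (hr : 0 < r) (ht : 0 < t) :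
    t ≤ Real.log (1 + q.pS * 1 * r ^ (-q.alpha) / q.noise) ↔
      r ≤ (q.pS / ((Real.exp t - 1) * q.noise)) ^ (1 / q.alpha) := by
  have he := exp_sub_one_pos ht
  have hp := hq.pS_pos
  have hn := hq.noise_pos
  have ha := hq.alpha_pos
  have hrp : 0 < r ^ q.alpha := Real.rpow_pos_of_pos hr _
  rw [one_div, Real.le_rpow_inv_iff_of_pos hr.le (by positivity) ha,
    Real.le_log_iff_exp_le (by positivity), ← sub_le_iff_le_add', Real.rpow_neg hr.le,
    le_div_iff₀ hn, mul_one, ← div_eq_mul_inv, le_div_iff₀ hrp, le_div_iff₀ (by positivity),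
    mul_comm]

theorem le_log_one_add_snr_iff (hq : q.Admissible) (g : ServingGain) {r t : ℝ} (hr : 0 < r)
    (ht : 0 < t) : t ≤ Real.log (1 + snr q g r) ↔ r ≤ snrRange q g t := by
  cases g with
  | always => exact le_log_one_add_iff_le_rpow hq hr ht
  | aboveHorizon =>
    simp only [snr, ServingGain.gain, snrRange, le_min_iff]
    split_ifs with h
    · rw [le_log_one_add_iff_le_rpow hq hr ht, and_iff_left h]
    -- Beyond the horizon the SNR is 0 and its logarithm 0 lies below t, while r exceeds the
    -- minimum: both sides fail.
    · simp [h, ht]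

variable {Ω : Type*} [MeasurableSpace Ω] {P : Measure Ω} [IsProbabilityMeasure P]
  {u : E3} {X : Fin q.N → Ω → E3} {c : Ω → Fin q.N → Fin q.K} {G : Fin q.N → Ω → ℝ}

theorem measureReal_le_log_one_add_snr (hq : q.Admissible) (hnet : IsNetwork q P u X c G)
    (g : ServingGain) {t : ℝ} (ht : 0 < t) :
    P.real {w | t ≤ Real.log (1 + snr q g (R0 q u X w))} =
      cdf (P.map (R0 q u X)) (snrRange q g t) := by
  have hR := measurable_R0 (u := u) hnet.measurable_X
  have : IsProbabilityMeasure (P.map (R0 q u X)) :=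
    Measure.isProbabilityMeasure_map hR.aemeasurable
  rw [cdf_eq_real, map_measureReal_apply hR measurableSet_Iic]
  refine measureReal_congr ?_
  filter_upwards [rMin_le_R0 hq hnet] with w hw
  exact propext (le_log_one_add_snr_iff hq g (hq.rMin_pos.trans_le hw) ht)

theorem log_one_add_snr_eq (q : Params) (g : ServingGain) (r : ℝ) :
    Real.log (1 + snr q g r) = Real.log 2 * spectral q g r 0 := by
  have : Real.log 2 ≠ 0 := (Real.log_pos one_lt_two).ne'
  rw [spectral_zero, Real.logb]
  field_simp

/-- The interference-free rate as an integral of the distribution function of the serving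
distance. -/
theorem snr_rate_eq_integral_cdf (hq : q.Admissible) (hnet : IsNetwork q P u X c G)
    (g : ServingGain) :
    IntegrableOn (fun t : ℝ => cdf (P.map (R0 q u X)) (snrRange q g t)) (Set.Ioi 0) ∧
    ∫ w, Real.logb 2 (1 + snr q g (R0 q u X w)) ∂P =
      1 / Real.log 2 * ∫ t in Set.Ioi (0 : ℝ), cdf (P.map (R0 q u X)) (snrRange q g t) := by
  have hl2 := Real.log_pos one_lt_two
  have hL : Integrable (fun w => Real.log (1 + snr q g (R0 q u X w))) P := by
    refine ((integrable_snr_rate hq hnet g).const_mul (Real.log 2)).congr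
      (Eventually.of_forall fun w => ?_)
    simp only
    rw [log_one_add_snr_eq, spectral_zero]
  have hL0 : 0 ≤ᵐ[P] fun w => Real.log (1 + snr q g (R0 q u X w)) := by
    filter_upwards [rMin_le_R0 hq hnet] with w hw
    rw [log_one_add_snr_eq]
    exact mul_nonneg hl2.le (spectral_nonneg hq g (hq.rMin_pos.le.trans hw) le_rfl)
  have hcongr : ∀ t ∈ Set.Ioi (0 : ℝ), P.real {w | t ≤ Real.log (1 + snr q g (R0 q u X w))} =
      cdf (P.map (R0 q u X)) (snrRange q g t) :=
    fun t ht => measureReal_le_log_one_add_snr hq hnet g ht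
  constructor
  · refine IntegrableOn.congr_fun ?_ hcongr measurableSet_Ioi
    -- The factor ln 2 converts the maximal rate from bits to nats; beyond it the tail probability
    -- is 0, since R_0 ≥ r_min almost surely.
    refine Integrable.mono' (integrable_indicator_Iic_const (Real.log 2 * q.maxSpectral) 1) ?_ ?_
    · refine (Antitone.measurable fun s t hst => ?_).aestronglyMeasurable
      exact measureReal_mono fun w hw => hst.trans hw
    · refine Eventually.of_forall fun t => ?_
      rw [Real.norm_eq_abs, abs_of_nonneg measureReal_nonneg]
      by_cases ht : t ≤ Real.log 2 * q.maxSpectral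
      · rw [Set.indicator_of_mem (by exact ht)]
        exact measureReal_le_one
      · rw [Set.indicator_of_notMem (by exact ht)]
        refine le_of_eq ?_
        rw [measureReal_def, ENNReal.toReal_eq_zero_iff]
        left
        refine measure_mono_null ?_ (rMin_le_R0 hq hnet)
        intro w hw hle
        refine ht (le_trans hw ?_)
        rw [log_one_add_snr_eq]
        exact mul_le_mul_of_nonneg_left (spectral_le hq g hle le_rfl) hl2.le
  -- Layer cake with the closed inequality, which matches the event R_0 ≤ r of the distribution
  -- function.
  · rw [← setIntegral_congr_fun measurableSet_Ioi hcongr,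
      ← hL.integral_eq_integral_meas_le hL0, ← integral_const_mul]
    refine integral_congr_ae (Eventually.of_forall fun w => ?_)
    simp only [Real.logb]
    ring

end SnrTerm

/-! ### The SINR term. -/

section SinrTerm

variable {q : Params}

/-- The weight `(1 - F(r))^(N-1) r`, proportional to the density of the serving distance above the
horizon. -/
noncomputable def Params.sinrWeight (q : Params) (r : ℝ) : ℝ :=
  (1 - (r ^ 2 - q.rMin ^ 2) / (4 * q.rE * (q.rE + q.rMin))) ^ (q.N - 1) * r

theorem distPdf_mul_minWeight (q : Params) (r : ℝ) :
    q.distPdf r * q.minWeight r = q.N / (2 * q.rE * (q.rE + q.rMin)) * q.sinrWeight r := by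
  rw [Params.distPdf, Params.minWeight, Params.sinrWeight, Params.distCdf]
  ring

theorem measurable_distPdf (q : Params) : Measurable q.distPdf := by
  unfold Params.distPdf
  fun_prop

theorem sinrWeight_nonneg (hq : q.Admissible) {r : ℝ} (hr : r ∈ Set.Ioo q.rMin q.rMax) :
    0 ≤ q.sinrWeight r := by
  have h0 := hq.rMin_pos.trans hr.1
  exact mul_nonneg (pow_nonneg (sub_nonneg.2 (distCdf_lt_one hq h0.le hr.2.le).le) _) h0.le

theorem sinrWeight_le (hq : q.Admissible) {r : ℝ} (hr : r ∈ Set.Ioo q.rMin q.rMax) :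
    q.sinrWeight r ≤ q.rMax := by
  have h0 := hq.rMin_pos.trans hr.1
  have h1 := distCdf_lt_one hq h0.le hr.2.le
  have h2 := distCdf_nonneg hq hr.1.le
  have h3 : (1 - q.distCdf r) ^ (q.N - 1) ≤ 1 := pow_le_one₀ (by linarith) (by linarith)
  calc q.sinrWeight r = (1 - q.distCdf r) ^ (q.N - 1) * r := rfl
    _ ≤ 1 * r := mul_le_mul_of_nonneg_right h3 h0.le
    _ ≤ q.rMax := by linarith [hr.2]

variable {Ω : Type*} [MeasurableSpace Ω] {P : Measure Ω} {u : E3}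
  {X : Fin q.N → Ω → E3} {c : Ω → Fin q.N → Fin q.K} {G : Fin q.N → Ω → ℝ}

/-- Above the horizon the serving distance has an explicit density. -/
theorem map_R0_restrict_Iic_eq_withDensity (hq : q.Admissible) (hnet : IsNetwork q P u X c G) :
    (P.map (R0 q u X)).restrict (Set.Iic q.rMax) =
      (volume.restrict (Set.Ioo q.rMin q.rMax)).withDensity
        fun r => ENNReal.ofReal (q.distPdf r * q.minWeight r) := by
  rw [map_R0_restrict hq hnet, distLaw_restrict_Iic hq hnet.norm_user,
    ← withDensity_mul _ (measurable_distPdf q).ennreal_ofReal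
      (measurable_minWeight q).ennreal_ofReal]
  refine withDensity_congr_ae ?_
  filter_upwards [ae_restrict_mem measurableSet_Ioo] with r hr
  have := hq.rE_pos
  have := hq.rMin_pos
  have h0 := hq.rMin_pos.trans hr.1
  rw [Pi.mul_apply, ← ENNReal.ofReal_mul (by unfold Params.distPdf; positivity)]

theorem ae_Iic_map_R0_of_ae_volume (hq : q.Admissible) (hnet : IsNetwork q P u X c G)
    {p : ℝ → Prop} (h : ∀ᵐ r ∂(volume.restrict (Set.Ioo q.rMin q.rMax)), p r) :
    ∀ᵐ r ∂((P.map (R0 q u X)).restrict (Set.Iic q.rMax)), p r := by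
  rw [map_R0_restrict_Iic_eq_withDensity hq hnet]
  exact (withDensity_absolutelyContinuous _ _).ae_le h

theorem setIntegral_map_R0_Iic (hq : q.Admissible) (hnet : IsNetwork q P u X c G) (φ : ℝ → ℝ) :
    ∫ r in Set.Iic q.rMax, φ r ∂(P.map (R0 q u X)) =
      q.N / (2 * q.rE * (q.rE + q.rMin)) *
        ∫ r in Set.Ioo q.rMin q.rMax, q.sinrWeight r * φ r := by
  have hE := hq.rE_pos
  have hm := hq.rMin_pos
  have hmeas : Measurable fun r => ENNReal.ofReal (q.distPdf r * q.minWeight r) :=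
    ((measurable_distPdf q).mul (measurable_minWeight q)).ennreal_ofReal
  rw [map_R0_restrict_Iic_eq_withDensity hq hnet,
    integral_withDensity_eq_integral_toReal_smul hmeas (Eventually.of_forall fun _ => ENNReal.ofReal_lt_top), ← integral_const_mul]
  refine setIntegral_congr_fun measurableSet_Ioo fun r hr => ?_
  rw [distPdf_mul_minWeight, ENNReal.toReal_ofReal (mul_nonneg (by positivity)
    (sinrWeight_nonneg hq hr)), smul_eq_mul, mul_assoc]

variable [IsProbabilityMeasure P]

/-- When channels are shared, every serving distance above the horizon is compatible with
interference. -/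
theorem volume_absolutelyContinuous_map_R0_NI_pos (hq : q.Admissible) (hKN : q.K < q.N)
    (hnet : IsNetwork q P u X c G) :
    volume.restrict (Set.Ioo q.rMin q.rMax) ≪
      (P.restrict {w | 0 < NI q u X c w}).map (R0 q u X) := by
  have hE := hq.rE_pos
  have hm := hq.rMin_pos
  have hmeas : Measurable fun r => ENNReal.ofReal (q.distPdf r * q.minWeight r) :=
    ((measurable_distPdf q).mul (measurable_minWeight q)).ennreal_ofReal
  have hmeas' : Measurable fun r => ENNReal.ofReal (1 - q.P0 r) :=
    (measurable_const.sub (measurable_P0 q)).ennreal_ofReal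
  refine Measure.AbsolutelyContinuous.trans ?_
    (Measure.absolutelyContinuous_of_le (Measure.restrict_le_self (s := Set.Iic q.rMax)))
  rw [map_R0_restrict_NI_pos hq hnet, restrict_withDensity measurableSet_Iic,
    map_R0_restrict_Iic_eq_withDensity hq hnet, ← withDensity_mul _ hmeas hmeas']
  -- It remains to see that the density does not vanish inside the interval; this uses F(r) < 1 and,
  -- through K < N, P_0(r) < 1.
  refine withDensity_absolutelyContinuous' (hmeas.mul hmeas').aemeasurable ?_
  filter_upwards [ae_restrict_mem measurableSet_Ioo] with r hr
  have h0 := hq.rMin_pos.trans hr.1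
  have h1 := distCdf_lt_one hq h0.le hr.2.le
  have h2 := P0_lt_one hq hKN h0.le hr.2
  have h3 : (0 : ℝ) < q.N := by exact_mod_cast hq.N_pos
  have h4 : 0 < (1 - q.distCdf r) ^ (q.N - 1) := pow_pos (by linarith) _
  rw [Pi.mul_apply]
  refine mul_ne_zero ?_ ?_
  · rw [Ne, ENNReal.ofReal_eq_zero, not_le]
    unfold Params.distPdf Params.minWeight
    positivity
  · rw [Ne, ENNReal.ofReal_eq_zero, not_le]
    linarith

/-- Valid for every r and t, as the chosen conditional law is a probability measure at every r. Only
the identification of the limit with the rate is restricted to almost every r. -/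
theorem tendsto_fourierIntegrand (r t : ℝ) :
    Tendsto (fun A : ℝ => ∫ ω in (-A)..A, fourierIntegrand q u X c G P r t ω) atTop
      (𝓝 ((signTail (lawGivenInterf q u X c P (interference q u X c G) r)
        (threshold q.pS (r ^ q.alpha) q.noise t) : ℝ) : ℂ)) :=
  tendsto_intervalIntegral_gilPelaez
    (lawGivenInterf q u X c P (interference q u X c G) r) (threshold q.pS (r ^ q.alpha) q.noise t)

theorem improperIntegral_fourierIntegrand (r t : ℝ) :
    improperIntegral (fourierIntegrand q u X c G P r t) =
      ((signTail (lawGivenInterf q u X c P (interference q u X c G) r)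
        (threshold q.pS (r ^ q.alpha) q.noise t) : ℝ) : ℂ) :=
  (tendsto_fourierIntegrand r t).limUnder_eq

theorem measurable_signTail_lawGivenInterf :
    Measurable fun p : ℝ × ℝ => signTail (lawGivenInterf q u X c P (interference q u X c G) p.1)
      (threshold q.pS (p.1 ^ q.alpha) q.noise p.2) := by
  have hb : Measurable fun p : ((ℝ × Bool) × ℝ) × ℝ =>
      threshold q.pS (p.1.1.1 ^ q.alpha) q.noise p.1.2 := by
    unfold threshold
    fun_prop
  have h := (StronglyMeasurable.integral_kernel_prod_right'
    (κ := (condDistrib (interference q u X c G) (conditioner q u X c) P).comap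
      (Prod.fst : (ℝ × Bool) × ℝ → ℝ × Bool) measurable_fst)
    (f := fun p : ((ℝ × Bool) × ℝ) × ℝ => Real.pi *
      (Real.sign (threshold q.pS (p.1.1.1 ^ q.alpha) q.noise p.1.2 - p.2) + Real.sign p.2))
    (((measurable_sign.comp (hb.sub measurable_snd)).add
      (measurable_sign.comp measurable_snd)).const_mul _).stronglyMeasurable).measurable
  exact h.comp (((measurable_fst.prodMk measurable_const).prodMk measurable_snd :
    Measurable fun p : ℝ × ℝ => ((p.1, true), p.2)))

/-- When channels are shared, the conditional law given interference is described by the conditional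
law of a positive interference power, at almost every distance above the horizon. -/
theorem rateGivenInterf_ae_volume (hq : q.Admissible) (hKN : q.K < q.N)
    (hnet : IsNetwork q P u X c G) (g : ServingGain) :
    ∀ᵐ r ∂(volume.restrict (Set.Ioo q.rMin q.rMax)),
      rateGivenInterf q u X c G P g r =
        ∫ x, spectral q g r x ∂(lawGivenInterf q u X c P (interference q u X c G) r) ∧
      ∀ᵐ x ∂(lawGivenInterf q u X c P (interference q u X c G) r), 0 < x := by
  filter_upwards [(volume_absolutelyContinuous_map_R0_NI_pos hq hKN hnet).ae_le
    (rateGivenInterf_eq_of_NI_pos hq hnet g)] with r hr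
  refine ⟨hr.1, ?_⟩
  rw [ae_iff]
  convert! hr.2 using 2
  ext x
  simp

/-- Combines `integral_signTail` with the description of the rate by the law of I. Above the horizon
the serving gain is 1, so both conventions lead to the same Fourier integral. -/
theorem integral_signTail_eq_rateGivenInterf (hq : q.Admissible) (hKN : q.K < q.N)
    (hnet : IsNetwork q P u X c G) (g : ServingGain) :
    ∀ᵐ r ∂(volume.restrict (Set.Ioo q.rMin q.rMax)),
      ∫ t in Set.Ioi (0 : ℝ), signTail (lawGivenInterf q u X c P (interference q u X c G) r)
        (threshold q.pS (r ^ q.alpha) q.noise t) =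
      2 * Real.pi * Real.log 2 * rateGivenInterf q u X c G P g r := by
  filter_upwards [rateGivenInterf_ae_volume hq hKN hnet g, ae_restrict_mem measurableSet_Ioo]
    with r hr hrI
  have h0 := hq.rMin_pos.trans hrI.1
  have hl2 : Real.log 2 ≠ 0 := (Real.log_pos one_lt_two).ne'
  rw [integral_signTail _ hr.2 hq.pS_pos (Real.rpow_pos_of_pos h0 _) hq.noise_pos, hr.1,
    mul_assoc (2 * Real.pi), ← integral_const_mul (Real.log 2)]
  congr 1
  refine integral_congr_ae (Eventually.of_forall fun x => ?_)
  simp only [spectral, Real.logb]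
  rw [gain_of_le g hrI.2.le, Real.rpow_neg h0.le, mul_one, ← div_eq_mul_inv]
  field_simp

theorem abs_rateGivenInterf_le (hq : q.Admissible) (hKN : q.K < q.N)
    (hnet : IsNetwork q P u X c G) (g : ServingGain) :
    ∀ᵐ r ∂(volume.restrict (Set.Ioo q.rMin q.rMax)),
      |rateGivenInterf q u X c G P g r| ≤ q.maxSpectral := by
  filter_upwards [rateGivenInterf_ae_volume hq hKN hnet g, ae_restrict_mem measurableSet_Ioo]
    with r hr hrI
  have h0 := hq.rMin_pos.trans hrI.1
  have := norm_integral_le_of_norm_le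
    (μ := lawGivenInterf q u X c P (interference q u X c G) r)
    (integrable_const q.maxSpectral) (f := fun x => spectral q g r x)
    (hr.2.mono fun x hx => by
      rw [Real.norm_eq_abs, abs_of_nonneg (spectral_nonneg hq g h0.le hx.le)]
      exact spectral_le hq g hrI.1.le hx.le)
  rw [integral_const, probReal_univ, one_smul] at this
  rw [hr.1]
  exact this

theorem integrableOn_rateGivenInterf_aboveHorizon (hq : q.Admissible) (hKN : q.K < q.N)
    (hnet : IsNetwork q P u X c G) (g : ServingGain) :
    IntegrableOn (fun w => rateGivenInterf q u X c G P g (R0 q u X w))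
      {w | R0 q u X w ≤ q.rMax} P := by
  have hR := measurable_R0 (u := u) hnet.measurable_X
  have hm := measurable_rateGivenInterf (q := q) (u := u) (X := X) (c := c) (G := G) (P := P) g
  refine Integrable.of_bound (hm.comp hR).aestronglyMeasurable q.maxSpectral ?_
  have h := ae_Iic_map_R0_of_ae_volume hq hnet (abs_rateGivenInterf_le hq hKN hnet g)
  rw [Measure.restrict_map hR measurableSet_Iic] at h
  exact ae_of_ae_map hR.aemeasurable h

/-- Once the improper integral is replaced by its value, the integrand is bounded and vanishes for t
beyond the interference-free rate at the zenith, uniformly in r. -/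
theorem integrable_fourier_term (hq : q.Admissible) (hKN : q.K < q.N)
    (hnet : IsNetwork q P u X c G) :
    Integrable (fun p : ℝ × ℝ =>
        improperIntegral (fourierIntegrand q u X c G P p.1 p.2) * ((q.sinrWeight p.1 : ℝ) : ℂ))
      ((volume.restrict (Set.Ioo q.rMin q.rMax)).prod (volume.restrict (Set.Ioi 0))) := by
  simp_rw [improperIntegral_fourierIntegrand, ← Complex.ofReal_mul]
  suffices h : Integrable (fun p : ℝ × ℝ =>
      signTail (lawGivenInterf q u X c P (interference q u X c G) p.1)
        (threshold q.pS (p.1 ^ q.alpha) q.noise p.2) * q.sinrWeight p.1)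
      ((volume.restrict (Set.Ioo q.rMin q.rMax)).prod (volume.restrict (Set.Ioi 0))) from h.ofReal
  have hw : Measurable q.sinrWeight := by
    unfold Params.sinrWeight
    fun_prop
  refine Integrable.mono' ((((integrable_indicator_Iic_const
    (Real.log (1 + q.pS / q.rMin ^ q.alpha / q.noise)) (2 * Real.pi)).comp_snd
      (volume.restrict (Set.Ioo q.rMin q.rMax))).mul_const q.rMax))
    (measurable_signTail_lawGivenInterf.mul (hw.comp measurable_fst)).aestronglyMeasurable ?_
  -- Only the positivity of the interference is taken from `rateGivenInterf_ae_volume`, so the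
  -- choice of convention is immaterial.
  have h1 := (Measure.quasiMeasurePreserving_fst
    (μ := volume.restrict (Set.Ioo q.rMin q.rMax)) (ν := volume.restrict (Set.Ioi (0 : ℝ)))).ae
    ((rateGivenInterf_ae_volume hq hKN hnet .always).and (ae_restrict_mem measurableSet_Ioo))
  have h2 := (Measure.quasiMeasurePreserving_snd
    (μ := volume.restrict (Set.Ioo q.rMin q.rMax)) (ν := volume.restrict (Set.Ioi (0 : ℝ)))).ae
    (ae_restrict_mem measurableSet_Ioi)
  filter_upwards [h1, h2] with p hp ht
  obtain ⟨⟨-, hκ⟩, hr⟩ := hp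
  have hpS := hq.pS_pos
  have hm := hq.rMin_pos
  have hn := hq.noise_pos
  have h0 := hm.trans hr.1
  have hA : 0 < p.1 ^ q.alpha := Real.rpow_pos_of_pos h0 _
  have hB : 0 < q.rMin ^ q.alpha := Real.rpow_pos_of_pos hm _
  have hle : Real.log (1 + q.pS / p.1 ^ q.alpha / q.noise) ≤
      Real.log (1 + q.pS / q.rMin ^ q.alpha / q.noise) := by
    refine Real.log_le_log (by positivity) ?_
    have := Real.rpow_le_rpow hm.le hr.1.le hq.alpha_pos.le
    gcongr
  rw [Real.norm_eq_abs, abs_mul, abs_of_nonneg (sinrWeight_nonneg hq hr)]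
  refine mul_le_mul ?_ (sinrWeight_le hq hr) (sinrWeight_nonneg hq hr)
    (Set.indicator_nonneg (fun _ _ => by positivity) _)
  refine (abs_signTail_threshold_le _ hκ hpS hA hn ht).trans ?_
  exact Set.indicator_le_indicator_of_subset (Set.Iic_subset_Iic.2 hle)
    (fun _ => by positivity) _

theorem integral_fourier_term (r : ℝ) :
    ∫ t in Set.Ioi (0 : ℝ), improperIntegral (fourierIntegrand q u X c G P r t) *
        ((q.sinrWeight r : ℝ) : ℂ) =
      (((∫ t in Set.Ioi (0 : ℝ), signTail (lawGivenInterf q u X c P (interference q u X c G) r)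
        (threshold q.pS (r ^ q.alpha) q.noise t)) * q.sinrWeight r : ℝ) : ℂ) := by
  simp_rw [improperIntegral_fourierIntegrand]
  rw [integral_mul_const, integral_complex_ofReal, Complex.ofReal_mul]

/-- The rate given interference, averaged over serving distances above the horizon. -/
theorem setIntegral_rateGivenInterf_aboveHorizon (hq : q.Admissible) (hKN : q.K < q.N)
    (hnet : IsNetwork q P u X c G) (g : ServingGain) :
    ((∫ w in {w | R0 q u X w ≤ q.rMax}, rateGivenInterf q u X c G P g (R0 q u X w) ∂P : ℝ) : ℂ) =
      ((q.N / (4 * Real.pi * Real.log 2 * q.rE * (q.rE + q.rMin)) : ℝ) : ℂ) *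
        ∫ r in q.rMin..q.rMax, ∫ t in Set.Ioi (0 : ℝ),
          improperIntegral (fourierIntegrand q u X c G P r t) * ((q.sinrWeight r : ℝ) : ℂ) := by
  have hR := measurable_R0 (u := u) hnet.measurable_X
  have hE := hq.rE_pos
  have hm := hq.rMin_pos
  have hl2 := Real.log_pos one_lt_two
  have hpi := Real.pi_pos
  have hleft : ∫ w in {w | R0 q u X w ≤ q.rMax}, rateGivenInterf q u X c G P g (R0 q u X w) ∂P =
      ∫ r in Set.Iic q.rMax, rateGivenInterf q u X c G P g r ∂(P.map (R0 q u X)) :=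
    (setIntegral_map measurableSet_Iic (measurable_rateGivenInterf g).aestronglyMeasurable
      hR.aemeasurable).symm
  rw [hleft, setIntegral_map_R0_Iic hq hnet,
    intervalIntegral.integral_of_le hq.rMin_lt_rMax.le, integral_Ioc_eq_integral_Ioo]
  simp_rw [integral_fourier_term]
  rw [integral_complex_ofReal, ← Complex.ofReal_mul, ← integral_const_mul, ← integral_const_mul]
  congr 1
  refine integral_congr_ae ?_
  filter_upwards [integral_signTail_eq_rateGivenInterf hq hKN hnet g] with r hr
  -- The factor 2π ln 2 accounts for the passage from the density constant N / (2 rE (rE + rMin)) to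
  -- N / (4π ln 2 rE (rE + rMin)).
  rw [hr]
  field_simp
  ring

theorem one_sub_P0_of_eq (hq : q.Admissible) (hKN : ¬ q.K < q.N) (r : ℝ) : 1 - q.P0 r = 0 := by
  have hle := Nat.le_of_dvd hq.N_pos hq.K_dvd
  have heq : q.K = q.N := by omega
  rw [Params.P0, heq, Nat.div_self hq.N_pos]
  simp

/-- The contribution of interference to the average rate, as a Fourier integral. -/
theorem integral_one_sub_P0_mul_rateGivenInterf (hq : q.Admissible)
    (hnet : IsNetwork q P u X c G) (g : ServingGain) :
    ((1 / (q.K : ℝ) *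
      ∫ r, (1 - q.P0 r) * rateGivenInterf q u X c G P g r ∂(P.map (R0 q u X)) : ℝ) : ℂ) =
      ((q.N / (4 * Real.pi * Real.log 2 * q.K * q.rE * (q.rE + q.rMin)) : ℝ) : ℂ) *
        ∫ r in q.rMin..q.rMax, ∫ t in Set.Ioi (0 : ℝ), ((1 - q.P0 r : ℝ) : ℂ) *
          (improperIntegral (fourierIntegrand q u X c G P r t) * ((q.sinrWeight r : ℝ) : ℂ)) := by
  have hE := hq.rE_pos
  have hm := hq.rMin_pos
  have hl2 := Real.log_pos one_lt_two
  have hpi := Real.pi_pos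
  have hK : (0 : ℝ) < q.K := by exact_mod_cast hq.K_pos
  -- The factor 1 - P_0 vanishes beyond the horizon, so no law of R_0 is needed there.
  have hres : ∫ r in Set.Iic q.rMax, (1 - q.P0 r) * rateGivenInterf q u X c G P g r
      ∂(P.map (R0 q u X)) =
      ∫ r, (1 - q.P0 r) * rateGivenInterf q u X c G P g r ∂(P.map (R0 q u X)) := by
    refine setIntegral_eq_integral_of_forall_compl_eq_zero fun r hr => ?_
    have : ¬ r ≤ q.rMax := hr
    simp [Params.P0, this]
  rw [← hres, setIntegral_map_R0_Iic hq hnet,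
    intervalIntegral.integral_of_le hq.rMin_lt_rMax.le, integral_Ioc_eq_integral_Ioo]
  simp_rw [integral_const_mul, integral_fourier_term, ← Complex.ofReal_mul]
  rw [integral_complex_ofReal, ← Complex.ofReal_mul, ← integral_const_mul, ← integral_const_mul,
    ← integral_const_mul]
  congr 1
  by_cases hKN : q.K < q.N
  · refine integral_congr_ae ?_
    filter_upwards [integral_signTail_eq_rateGivenInterf hq hKN hnet g] with r hr
    rw [hr]
    field_simp
    ring
  -- For K = N conditioning on interference is meaningless, but its arbitrary values are multiplied
  -- by 1 - P_0 = 0 on both sides.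
  · simp [one_sub_P0_of_eq hq hKN]

end SinrTerm

end Leo

/-! ### Assembly. -/

theorem theorem4 (q : Leo.Params) (hq : q.Admissible)
    {Ω : Type*} [MeasurableSpace Ω] (P : Measure Ω) [IsProbabilityMeasure P] (u : Leo.E3)
    (X : Fin q.N → Ω → Leo.E3) (c : Ω → Fin q.N → Fin q.K) (G : Fin q.N → Ω → ℝ)
    (hnet : Leo.IsNetwork q P u X c G) (g : Leo.ServingGain) :
    -- `P_0(r)` is the conditional probability of no interference given `R_0 = r`
    (∀ᵐ r ∂(P.map (Leo.R0 q u X)),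
      (Leo.lawGivenR0 q u X P (Leo.NI q u X c) r).real {0} = q.P0 r) ∧
    -- the rate is a genuine expectation
    Integrable (fun w => Real.logb 2 (1 + Leo.sinr q u X c G g w)) P ∧
    -- splitting of the rate given `R_0 = r`
    (∀ᵐ r ∂(P.map (Leo.R0 q u X)),
      1 / (q.K : ℝ) * ∫ z, z ∂(Leo.lawGivenR0 q u X P
          (fun w => Real.logb 2 (1 + Leo.sinr q u X c G g w)) r) =
        q.P0 r / q.K * Real.logb 2 (1 + Leo.snr q g r) +
          (1 - q.P0 r) / q.K * Leo.rateGivenInterf q u X c G P g r) ∧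
    -- splitting of the average rate
    Integrable (fun w => q.P0 (Leo.R0 q u X w) *
      Real.logb 2 (1 + Leo.snr q g (Leo.R0 q u X w))) P ∧
    Integrable (fun w => (1 - q.P0 (Leo.R0 q u X w)) *
      Leo.rateGivenInterf q u X c G P g (Leo.R0 q u X w)) P ∧
    Leo.avgRate q u X c G P g =
      1 / (q.K : ℝ) * ∫ w, q.P0 (Leo.R0 q u X w) *
        Real.logb 2 (1 + Leo.snr q g (Leo.R0 q u X w)) ∂P +
      1 / (q.K : ℝ) * ∫ w, (1 - q.P0 (Leo.R0 q u X w)) *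
        Leo.rateGivenInterf q u X c G P g (Leo.R0 q u X w) ∂P ∧
    -- the second summand is the contribution of the event `N_I > 0`
    (∫ w in {w | 0 < Leo.NI q u X c w}, Real.logb 2 (1 + Leo.sinr q u X c G g w) ∂P) =
      ∫ w, (1 - q.P0 (Leo.R0 q u X w)) *
        Leo.rateGivenInterf q u X c G P g (Leo.R0 q u X w) ∂P ∧
    -- the SNR term, for `G_0 = 1` throughout
    (g = Leo.ServingGain.always →
      Integrable (fun w => Real.logb 2 (1 + Leo.snr q g (Leo.R0 q u X w))) P ∧
      IntegrableOn (fun t : ℝ => cdf (P.map (Leo.R0 q u X))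
        ((q.pS / ((Real.exp t - 1) * q.noise)) ^ (1 / q.alpha))) (Set.Ioi 0) ∧
      ∫ w, Real.logb 2 (1 + Leo.snr q g (Leo.R0 q u X w)) ∂P =
        1 / Real.log 2 * ∫ t in Set.Ioi (0 : ℝ), cdf (P.map (Leo.R0 q u X))
          ((q.pS / ((Real.exp t - 1) * q.noise)) ^ (1 / q.alpha))) ∧
    -- the SNR term, for `G_0 = 0` when the serving satellite is below the horizon
    (g = Leo.ServingGain.aboveHorizon →
      Integrable (fun w => Real.logb 2 (1 + Leo.snr q g (Leo.R0 q u X w))) P ∧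
      IntegrableOn (fun t : ℝ => cdf (P.map (Leo.R0 q u X))
        (min ((q.pS / ((Real.exp t - 1) * q.noise)) ^ (1 / q.alpha)) q.rMax)) (Set.Ioi 0) ∧
      ∫ w, Real.logb 2 (1 + Leo.snr q g (Leo.R0 q u X w)) ∂P =
        1 / Real.log 2 * ∫ t in Set.Ioi (0 : ℝ), cdf (P.map (Leo.R0 q u X))
          (min ((q.pS / ((Real.exp t - 1) * q.noise)) ^ (1 / q.alpha)) q.rMax)) ∧
    -- the SINR term, as soon as channels are shared
    (q.K < q.N →
      (∀ᵐ r ∂(volume.restrict (Set.Ioo q.rMin q.rMax)), ∀ t : ℝ, 0 < t →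
        Leo.ImproperIntegrable (Leo.fourierIntegrand q u X c G P r t)) ∧
      Integrable (fun p : ℝ × ℝ =>
          Leo.improperIntegral (Leo.fourierIntegrand q u X c G P p.1 p.2) *
          (((1 - (p.1 ^ 2 - q.rMin ^ 2) / (4 * q.rE * (q.rE + q.rMin))) ^ (q.N - 1) * p.1 : ℝ) : ℂ))
        ((volume.restrict (Set.Ioo q.rMin q.rMax)).prod (volume.restrict (Set.Ioi 0))) ∧
      IntegrableOn (fun w => Leo.rateGivenInterf q u X c G P g (Leo.R0 q u X w))
        {w | Leo.R0 q u X w ≤ q.rMax} P ∧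
      ((∫ w in {w | Leo.R0 q u X w ≤ q.rMax},
          Leo.rateGivenInterf q u X c G P g (Leo.R0 q u X w) ∂P : ℝ) : ℂ) =
        ((q.N / (4 * Real.pi * Real.log 2 * q.rE * (q.rE + q.rMin)) : ℝ) : ℂ) *
          ∫ r in q.rMin..q.rMax, ∫ t in Set.Ioi (0 : ℝ),
            Leo.improperIntegral (Leo.fourierIntegrand q u X c G P r t) *
            (((1 - (r ^ 2 - q.rMin ^ 2) / (4 * q.rE * (q.rE + q.rMin))) ^ (q.N - 1) * r : ℝ) : ℂ)) ∧
    -- the average rate with the SINR part written out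
    ((Leo.avgRate q u X c G P g : ℝ) : ℂ) =
      ((1 / (q.K : ℝ) * ∫ w, q.P0 (Leo.R0 q u X w) *
        Real.logb 2 (1 + Leo.snr q g (Leo.R0 q u X w)) ∂P : ℝ) : ℂ) +
      ((q.N / (4 * Real.pi * Real.log 2 * q.K * q.rE * (q.rE + q.rMin)) : ℝ) : ℂ) *
        ∫ r in q.rMin..q.rMax, ∫ t in Set.Ioi (0 : ℝ), ((1 - q.P0 r : ℝ) : ℂ) *
          (Leo.improperIntegral (Leo.fourierIntegrand q u X c G P r t) *
          (((1 - (r ^ 2 - q.rMin ^ 2) / (4 * q.rE * (q.rE + q.rMin))) ^ (q.N - 1) * r : ℝ) : ℂ)) := by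
  have hR := Leo.measurable_R0 (u := u) hnet.measurable_X
  have i1 := Leo.integrable_P0_mul_snr_rate hq hnet g
  have i2 := Leo.integrable_one_sub_P0_mul_rate hq hnet g
  have e1 : ∫ w, q.P0 (Leo.R0 q u X w) * Real.logb 2 (1 + Leo.snr q g (Leo.R0 q u X w)) ∂P =
      ∫ r, q.P0 r * Real.logb 2 (1 + Leo.snr q g r) ∂(P.map (Leo.R0 q u X)) :=
    (integral_map hR.aemeasurable i1.aestronglyMeasurable).symm
  have e2 : ∫ w, (1 - q.P0 (Leo.R0 q u X w)) *
        Leo.rateGivenInterf q u X c G P g (Leo.R0 q u X w) ∂P =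
      ∫ r, (1 - q.P0 r) * Leo.rateGivenInterf q u X c G P g r ∂(P.map (Leo.R0 q u X)) :=
    (integral_map hR.aemeasurable i2.aestronglyMeasurable).symm
  have hsplit := Leo.setIntegral_rate_split hq hnet g MeasurableSet.univ
  simp only [Set.preimage_univ, Measure.restrict_univ] at hsplit
  have hpos := Leo.setIntegral_rate_NI_pos hq hnet g MeasurableSet.univ
  simp only [Set.preimage_univ, Set.univ_inter, Measure.restrict_univ] at hpos
  have havg : Leo.avgRate q u X c G P g =
      1 / (q.K : ℝ) * ∫ w, q.P0 (Leo.R0 q u X w) *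
        Real.logb 2 (1 + Leo.snr q g (Leo.R0 q u X w)) ∂P +
      1 / (q.K : ℝ) * ∫ w, (1 - q.P0 (Leo.R0 q u X w)) *
        Leo.rateGivenInterf q u X c G P g (Leo.R0 q u X w) ∂P := by
    rw [Leo.avgRate, hsplit, e1, e2, mul_add]
  refine ⟨Leo.lawGivenR0_NI_real_zero hq hnet, Leo.integrable_rate hq hnet g, ?_,
    i1.comp_measurable hR, i2.comp_measurable hR, havg, hpos.trans e2.symm, ?_, ?_, ?_, ?_⟩
  · filter_upwards [Leo.integral_lawGivenR0_rate hq hnet g] with r hr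
    rw [hr]
    ring
  · rintro rfl
    exact ⟨Leo.integrable_snr_rate hq hnet _, Leo.snr_rate_eq_integral_cdf hq hnet .always⟩
  · rintro rfl
    exact ⟨Leo.integrable_snr_rate hq hnet _, Leo.snr_rate_eq_integral_cdf hq hnet .aboveHorizon⟩
  · intro hKN
    exact ⟨Eventually.of_forall fun r t _ => ⟨_, Leo.tendsto_fourierIntegrand r t⟩,
      Leo.integrable_fourier_term hq hKN hnet,
      Leo.integrableOn_rateGivenInterf_aboveHorizon hq hKN hnet g,
      Leo.setIntegral_rateGivenInterf_aboveHorizon hq hKN hnet g⟩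
  · rw [havg, Complex.ofReal_add, e2]
    -- The explicit weight in the goal is `Params.sinrWeight` by definition.
    exact congrArg _ (Leo.integral_one_sub_P0_mul_rateGivenInterf hq hnet g)
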